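/- Let $N\ge 1$ be an integer and let $(\Omega,\mathcal F,(\mathcal F_n)_{0\le n\le N},\mathbb P)$ be a filtered probability space ($\mathcal F_0$ need not be trivial). Let $S=(S_n)_{0\le n\le N}$ be a real adapted process and put $\Delta S_n=S_n-S_{n-1}$; assume that $S$ is locally square integrable, i.e. $\mathbb E[(\Delta S_n)^2\mid\mathcal F_{n-1}]<\infty$ a.s. for $1\le n\le N$. Let $H=(H_n)_{0\le n\le N}$ and $\omega=(\omega_n)_{0\le n\le N}$ be adapted, with $H_n\in L^2(\mathbb P)$ and $\omega_n\in[0,1]$ a.s. for all $n$. Let $\mathcal A$ be the set of all processes $\xi=(\xi_n)_{1\le n\le N}$ such that $\xi_n$ is real valued and $\mathcal F_{n-1}$-measurable (no integrability is required), and for $\xi\in\mathcal A$ and $c\in\mathbb R$ put $$G_n(\xi)=\sum_{i=1}^n\xi_i\,\Delta S_i,\qquad J(c,\xi)=\sum_{n=0}^N\mathbb E\big[\omega_n\,(H_n-c-G_n(\xi))^2\big]\in[0,\infty],\qquad V(c)=\inf_{\xi\in\mathcal A}J(c,\xi).$$ For a random variable $X$ with $\mathbb E[|X|\mid\mathcal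 G]<\infty$ a.s. (not necessarily integrable), write $\mathbb E[X\mid\mathcal G]=\mathbb E[X^+\mid\mathcal G]-\mathbb E[X^-\mid\mathcal G]$. With empty sums equal to $0$, empty products equal to $1$ and $0/0=0$, define by backward induction for $n=N,N-1,\dots,1$ $$\alpha_n=\mathbb E\Big[\Delta S_n\sum_{i=n}^N\omega_i\prod_{j=n+1}^i(1-\beta_j\Delta S_j)\,\Big|\,\mathcal F_{n-1}\Big],\qquad \eta_n=\mathbb E\Big[\Delta S_n\sum_{i=n}^N H_i\,\omega_i\prod_{j=n+1}^i(1-\beta_j\Delta S_j)\,\Big|\,\mathcal F_{n-1}\Big],$$ $$\delta_n=\mathbb E\Big[(\Delta S_n)^2\sum_{i=n}^N\omega_i\prod_{j=n+1}^i(1-\beta_j\Delta S_j)^2\,\Big|\,\mathcal F_{n-1}\Big],\qquad \beta_n=\frac{\alpha_n}{\delta_n},\qquad \rho_n=\frac{\eta_n}{\delta_n}.$$ For $c\in\mathbb R$ define the strategy $\xi^\star(c)$ recursively by $$\xi_n^\star(c)=\rho_n-\beta_n\big(c+G_{n-1}(\xi^\star(c))\big),\qquad 1\le n\le N,$$ and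 set $$Z_n=\omega_n\prod_{i=1}^n(1-\beta_i\Delta S_i)\quad(0\le n\le N),\qquad c^\star=\frac{\sum_{n=0}^N\mathbb E[Z_nH_n]}{\sum_{n=0}^N\mathbb E[Z_n]},$$ with $c^\star=0$ if the denominator is $0$. **Theorem.** These quantities are well defined: the three random variables whose conditional expectations are taken in $\alpha_n,\eta_n,\delta_n$ satisfy $\mathbb E[|\cdot|\mid\mathcal F_{n-1}]<\infty$ a.s.; almost surely $\alpha_n=\eta_n=0$ wherever $\delta_n=0$; $Z_n$ and $Z_nH_n$ are integrable; and $\sum_n\mathbb E[Z_nH_n]=0$ if $\sum_n\mathbb E[Z_n]=0$. For every $c\in\mathbb R$, $\xi^\star(c)\in\mathcal A$ and $J(c,\xi^\star(c))=V(c)$, and $V(c^\star)\le V(c)$. Consequently $(c^\star,\xi^\star(c^\star))$ is an optimal solution of the problem $$\min_{c\in\mathbb R}\ \min_{\xi\in\mathcal A}\ \sum_{n=0}^N\mathbb E\big[\omega_n\,(H_n-c-G_n(\xi))^2\big],$$ i.e. $J(c^\star,\xi^\star(c^\star))<\infty$ and $J(c^\star,\xi^\star(c^\star))\le J(c,\xi)$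 for all $c\in\mathbb R$ and all $\xi\in\mathcal A$. -/

import Mathlib

open MeasureTheory
open scoped ENNReal

namespace QuadHedge

variable {Ω : Type*} {mΩ : MeasurableSpace Ω}

/-- The generalized conditional expectation `E[X | m] = E[X⁺ | m] - E[X⁻ | m]` of a real random
variable `X`, where the conditional expectations of the nonnegative parts are taken in `[0, ∞]`.
It is meaningful as soon as `E[|X| | m] < ∞` almost surely; `X` need not be integrable. -/
noncomputable def gCondExp (m : MeasurableSpace Ω) (P : Measure[mΩ] Ω) (X : Ω → ℝ) : Ω → ℝ :=
  fun x => (condLExp m P (fun y => ENNReal.ofReal (X y)) x).toReal -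
    (condLExp m P (fun y => ENNReal.ofReal (-X y)) x).toReal

/-- `E[|X| | m] < ∞` almost surely. -/
def CondIntegrable (m : MeasurableSpace Ω) (P : Measure[mΩ] Ω) (X : Ω → ℝ) : Prop :=
  ∀ᵐ x ∂P, condLExp m P (fun y => ‖X y‖ₑ) x < ∞

/-- For integrable random variables this is the usual conditional expectation. -/
theorem gCondExp_ae_eq_condExp {m : MeasurableSpace Ω} {P : Measure[mΩ] Ω} {X : Ω → ℝ}
    (hX : Integrable X P) : gCondExp m P X =ᵐ[P] P[X | m] := by
  have hn : Integrable (fun y => -X y) P := hX.neg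
  have h1 := toReal_condLExp m (f := fun y => ENNReal.ofReal (X y))
    hX.aestronglyMeasurable.aemeasurable.ennreal_ofReal hX.lintegral_lt_top.ne
  have h2 := toReal_condLExp m (f := fun y => ENNReal.ofReal (-X y))
    hn.aestronglyMeasurable.aemeasurable.ennreal_ofReal hn.lintegral_lt_top.ne
  have h3 := condExp_sub (hX.real_toNNReal) (hn.real_toNNReal) m
  have h4 : (fun y => ((X y).toNNReal : ℝ)) - (fun y => ((-X y).toNNReal : ℝ)) = X := by
    funext y
    simp only [Pi.sub_apply, Real.coe_toNNReal']
    exact max_zero_sub_eq_self (X y)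
  rw [h4] at h3
  filter_upwards [h1, h2, h3] with x e1 e2 e3
  rw [e3]
  simp only [gCondExp, Pi.sub_apply]
  rw [e1, e2]
  rfl

/-- The price increment `ΔS n = S n - S (n - 1)`; by truncated subtraction `ΔS 0 = 0`. -/
def incr (S : ℕ → Ω → ℝ) (n : ℕ) (x : Ω) : ℝ := S n x - S (n - 1) x

/-- Cumulative gains `G n = ∑_{i=1}^n ξ i * ΔS i` of a self-financing strategy. -/
def gain (S ξ : ℕ → Ω → ℝ) (n : ℕ) (x : Ω) : ℝ :=
  ∑ i ∈ Finset.Icc 1 n, ξ i x * incr S i x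

/-- Admissible strategies: `ξ n` is `F (n - 1)`-measurable for `n = 1, …, N`. -/
def Admissible (F : Filtration ℕ mΩ) (N : ℕ) (ξ : ℕ → Ω → ℝ) : Prop :=
  ∀ n, 1 ≤ n → n ≤ N → Measurable[F (n - 1)] (ξ n)

/-- The quadratic hedging error `∑_{n=0}^N E[w n * (H n - c - G n ξ)²]`, with values in
`[0, ∞]`. -/
noncomputable def hedgingError (P : Measure Ω) (S H w : ℕ → Ω → ℝ) (N : ℕ) (c : ℝ)
    (ξ : ℕ → Ω → ℝ) : ℝ≥0∞ :=
  ∑ n ∈ Finset.range (N + 1),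
    ∫⁻ x, ENNReal.ofReal (w n x * (H n x - c - gain S ξ n x) ^ 2) ∂P

/-- The value function `V c`: the infimum of the hedging error over admissible strategies. -/
noncomputable def valueFn (P : Measure Ω) (F : Filtration ℕ mΩ) (S H w : ℕ → Ω → ℝ) (N : ℕ)
    (c : ℝ) : ℝ≥0∞ :=
  ⨅ (ξ : ℕ → Ω → ℝ) (_ : Admissible F N ξ), hedgingError P S H w N c ξ

/-- `∏_{j=n+1}^i (1 - b j * ΔS j)`. -/
def discProd (S b : ℕ → Ω → ℝ) (n i : ℕ) (x : Ω) : ℝ :=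
  ∏ j ∈ Finset.Ioc n i, (1 - b j x * incr S j x)

/-- `ΔS n * ∑_{i=n}^N w i * ∏_{j=n+1}^i (1 - b j * ΔS j)`. -/
def alphaArg (S w : ℕ → Ω → ℝ) (N : ℕ) (b : ℕ → Ω → ℝ) (n : ℕ) (x : Ω) : ℝ :=
  incr S n x * ∑ i ∈ Finset.Icc n N, w i x * discProd S b n i x

/-- `ΔS n * ∑_{i=n}^N H i * w i * ∏_{j=n+1}^i (1 - b j * ΔS j)`. -/
def etaArg (S H w : ℕ → Ω → ℝ) (N : ℕ) (b : ℕ → Ω → ℝ) (n : ℕ) (x : Ω) : ℝ :=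
  incr S n x * ∑ i ∈ Finset.Icc n N, H i x * w i x * discProd S b n i x

/-- `(ΔS n)² * ∑_{i=n}^N w i * ∏_{j=n+1}^i (1 - b j * ΔS j)²`. -/
def deltaArg (S w : ℕ → Ω → ℝ) (N : ℕ) (b : ℕ → Ω → ℝ) (n : ℕ) (x : Ω) : ℝ :=
  incr S n x ^ 2 * ∑ i ∈ Finset.Icc n N, w i x * discProd S b n i x ^ 2

/-- Backward construction of `β`: after `k` steps the values at the times `N, …, N - k + 1` are
in place, and the next step fills in time `N - k` from them. -/
noncomputable def betaStep (P : Measure Ω) (F : Filtration ℕ mΩ) (S w : ℕ → Ω → ℝ) (N : ℕ) :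
    ℕ → ℕ → Ω → ℝ
  | 0 => fun _ _ => 0
  | k + 1 => Function.update (betaStep P F S w N k) (N - k) (fun x =>
      gCondExp (F (N - k - 1)) P (alphaArg S w N (betaStep P F S w N k) (N - k)) x /
      gCondExp (F (N - k - 1)) P (deltaArg S w N (betaStep P F S w N k) (N - k)) x)

/-- The process `β`, with `β 0 = 0`; see `beta_eq` for the defining relation
`β n = α n / δ n`, `1 ≤ n ≤ N`. -/
noncomputable def beta (P : Measure Ω) (F : Filtration ℕ mΩ) (S w : ℕ → Ω → ℝ) (N : ℕ) :
    ℕ → Ω → ℝ :=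
  betaStep P F S w N N

noncomputable def alpha (P : Measure Ω) (F : Filtration ℕ mΩ) (S w : ℕ → Ω → ℝ) (N n : ℕ) :
    Ω → ℝ :=
  gCondExp (F (n - 1)) P (alphaArg S w N (beta P F S w N) n)

noncomputable def eta (P : Measure Ω) (F : Filtration ℕ mΩ) (S H w : ℕ → Ω → ℝ) (N n : ℕ) :
    Ω → ℝ :=
  gCondExp (F (n - 1)) P (etaArg S H w N (beta P F S w N) n)

noncomputable def delta (P : Measure Ω) (F : Filtration ℕ mΩ) (S w : ℕ → Ω → ℝ) (N n : ℕ) :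
    Ω → ℝ :=
  gCondExp (F (n - 1)) P (deltaArg S w N (beta P F S w N) n)

/-- `ρ n = η n / δ n`, with `0 / 0 = 0`. -/
noncomputable def rho (P : Measure Ω) (F : Filtration ℕ mΩ) (S H w : ℕ → Ω → ℝ) (N n : ℕ)
    (x : Ω) : ℝ :=
  eta P F S H w N n x / delta P F S w N n x

theorem betaStep_stable (P : Measure Ω) (F : Filtration ℕ mΩ) (S w : ℕ → Ω → ℝ) (N : ℕ)
    {k l j : ℕ} (hkl : k ≤ l) (hl : l ≤ N) (hj : N - k < j) :
    betaStep P F S w N l j = betaStep P F S w N k j := by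
  induction l, hkl using Nat.le_induction with
  | base => rfl
  | succ l hkl ih =>
    rw [betaStep, Function.update_of_ne (by omega), ih (by omega)]

theorem discProd_congr (S : ℕ → Ω → ℝ) {b b' : ℕ → Ω → ℝ} {n i : ℕ}
    (h : ∀ j, n < j → b j = b' j) : discProd S b n i = discProd S b' n i := by
  funext x
  refine Finset.prod_congr rfl fun j hj => ?_
  rw [h j (Finset.mem_Ioc.1 hj).1]

/-- The backward recursion defining `β`. -/
theorem beta_eq (P : Measure Ω) (F : Filtration ℕ mΩ) (S w : ℕ → Ω → ℝ) {N n : ℕ}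
    (h1 : 1 ≤ n) (hn : n ≤ N) (x : Ω) :
    beta P F S w N n x = alpha P F S w N n x / delta P F S w N n x := by
  have hk : N - (N - n) = n := by omega
  have e1 : beta P F S w N n = betaStep P F S w N (N - n + 1) n :=
    betaStep_stable P F S w N (by omega) le_rfl (by omega)
  have e2 : ∀ j, n < j → betaStep P F S w N (N - n) j = beta P F S w N j := fun j hj =>
    (betaStep_stable P F S w N (by omega) le_rfl (by omega)).symm
  have e3 : alphaArg S w N (betaStep P F S w N (N - n)) n =
      alphaArg S w N (beta P F S w N) n := by
    funext y
    simp only [alphaArg, discProd_congr S e2]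
  have e4 : deltaArg S w N (betaStep P F S w N (N - n)) n =
      deltaArg S w N (beta P F S w N) n := by
    funext y
    simp only [deltaArg, discProd_congr S e2]
  rw [e1, betaStep, hk, Function.update_self, e3, e4]
  rfl

/-- The gains `G n (ξ*(c))`, computed forward together with the strategy `ξ*(c)`. -/
noncomputable def optGain (P : Measure Ω) (F : Filtration ℕ mΩ) (S H w : ℕ → Ω → ℝ) (N : ℕ)
    (c : ℝ) : ℕ → Ω → ℝ
  | 0 => fun _ => 0
  | n + 1 => fun x => optGain P F S H w N c n x +
      (rho P F S H w N (n + 1) x -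
        beta P F S w N (n + 1) x * (c + optGain P F S H w N c n x)) * incr S (n + 1) x

/-- The strategy `ξ*(c)`; see `optStrategy_eq` for the defining relation
`ξ* n = ρ n - β n * (c + G (n - 1) ξ*)`. -/
noncomputable def optStrategy (P : Measure Ω) (F : Filtration ℕ mΩ) (S H w : ℕ → Ω → ℝ) (N : ℕ)
    (c : ℝ) (n : ℕ) (x : Ω) : ℝ :=
  rho P F S H w N n x - beta P F S w N n x * (c + optGain P F S H w N c (n - 1) x)

theorem gain_optStrategy (P : Measure Ω) (F : Filtration ℕ mΩ) (S H w : ℕ → Ω → ℝ) (N : ℕ)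
    (c : ℝ) (n : ℕ) (x : Ω) :
    gain S (optStrategy P F S H w N c) n x = optGain P F S H w N c n x := by
  induction n with
  | zero => simp [gain, optGain]
  | succ n ih =>
    rw [gain, Finset.sum_Icc_succ_top (by omega), ← gain, ih]
    simp [optGain, optStrategy]

theorem optStrategy_eq (P : Measure Ω) (F : Filtration ℕ mΩ) (S H w : ℕ → Ω → ℝ) (N : ℕ)
    (c : ℝ) (n : ℕ) (x : Ω) :
    optStrategy P F S H w N c n x = rho P F S H w N n x -
      beta P F S w N n x * (c + gain S (optStrategy P F S H w N c) (n - 1) x) := by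
  rw [gain_optStrategy, optStrategy]

/-- `Z n = w n * ∏_{i=1}^n (1 - β i * ΔS i)`. -/
noncomputable def zProc (P : Measure Ω) (F : Filtration ℕ mΩ) (S w : ℕ → Ω → ℝ) (N n : ℕ)
    (x : Ω) : ℝ :=
  w n x * discProd S (beta P F S w N) 0 n x

/-- `c* = ∑ E[Z n * H n] / ∑ E[Z n]`, with `0 / 0 = 0`. -/
noncomputable def optCapital (P : Measure Ω) (F : Filtration ℕ mΩ) (S H w : ℕ → Ω → ℝ)
    (N : ℕ) : ℝ :=
  (∑ n ∈ Finset.range (N + 1), ∫ x, zProc P F S w N n x * H n x ∂P) /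
    (∑ n ∈ Finset.range (N + 1), ∫ x, zProc P F S w N n x ∂P)

end QuadHedge

/-!
The proof is dynamic programming, with the conditional expectations of non-integrable variables
handled by a strictly positive weight known to the conditioning σ-algebra (`HasCondExp`): after
multiplication by such a weight everything is integrable, so linearity, monotonicity, the pull-out
rule and the tower property all come from the ordinary conditional expectation.

Write `D n i = ∏_{j=n+1}^i (1 - β j ΔS j)`, and consider the tails `A n = ∑_{i≥n} w i (D n i)²`,
`B n = ∑_{i≥n} w i D n i` and `C n = ∑_{i≥n} H i w i D n i`. The cost from time `n` on of the
candidate strategy started from wealth `u` is a nonnegative quadratic `L n - 2 u Q n + u² A n`.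
Two identities drive the backward induction: `E[A n | F n] = E[B n | F n]` and
`E[Q n | F n] = E[C n | F n]`. They hold because `β n` and `ρ n` satisfy `β n δ n = α n` and
`ρ n δ n = η n`, and by the tower property they turn the definitions of `α n`, `η n` into
`α n = E[ΔS n A n | F (n - 1)]` and `η n = E[ΔS n Q n | F (n - 1)]`. Hence the conditional cost of
holding `ξ` over the `n`-th period from wealth `v` is a quadratic in `ξ` with leading coefficient
`δ n` and minimiser `ρ n - β n v` (`lintegral_cost_le`). The same computation gives
`E[A (n - 1) | F (n - 1)] ≤ w (n - 1) + E[A n | F (n - 1)]` and a similar bound for `L`, so `A` and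
`L` stay integrable although `β` and `ρ` need not be bounded (`IsUnitTail.step`,
`IsCostTail.step`).

The Cauchy-Schwarz inequalities `B² ≤ (N + 1) A`, `C² ≤ (∑ w i H i²) A` and `Q² ≤ L A` give the
conditional integrability of the remaining variables, and show that `α n` and `η n` vanish where
`δ n` does.

At time `0` the minimal cost with capital `c` is `E[L 0] - 2 c E[Q 0] + c² E[A 0]`, where
`E[A 0] = E[B 0] = ∑ E[Z n]` and `E[Q 0] = E[C 0] = ∑ E[Z n H n]`, so it is smallest at the quotient
`c*`; if `E[A 0] = 0`, then `Q 0 = 0` almost surely and the cost does not depend on `c`.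
-/

namespace QuadHedge

/-! ### Conditional expectations of non-integrable variables -/

section CondExp

variable {Ω : Type*} {m m' mΩ : MeasurableSpace Ω} {P : Measure[mΩ] Ω}
  {X X' Y Y' Z : Ω → ℝ}

theorem lintegral_mul_condLExp [IsProbabilityMeasure P] (hm : m ≤ mΩ) {f X : Ω → ℝ≥0∞}
    (hf : Measurable[m] f) (hX : AEMeasurable X P) :
    ∫⁻ x, f x * condLExp m P X x ∂P = ∫⁻ x, f x * X x ∂P := by
  have hf' : Measurable f := hf.mono hm le_rfl
  -- Both integrals are integrals of `f` for the restrictions to `m` of the measures with densities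
  -- `E[X | m]` and `X`, and these restrictions agree.
  have key : ∀ Y : Ω → ℝ≥0∞, AEMeasurable Y P →
      ∫⁻ x, f x * Y x ∂P = ∫⁻ x, f x ∂((P.withDensity Y).trim hm) := by
    intro Y hY
    rw [lintegral_trim hm hf, lintegral_withDensity_eq_lintegral_mul₀ hY hf'.aemeasurable]
    exact lintegral_congr fun x => mul_comm _ _
  rw [key _ (measurable_condLExp' m P X).aemeasurable, key X hX]
  congr 1
  refine @Measure.ext _ m _ _ fun s hs => ?_
  rw [trim_measurableSet_eq hm hs, trim_measurableSet_eq hm hs, withDensity_apply _ (hm s hs),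
    withDensity_apply _ (hm s hs), setLIntegral_condLExp hm P X hs]

theorem condLExp_mul_left [IsProbabilityMeasure P] (hm : m ≤ mΩ) {f X : Ω → ℝ≥0∞}
    (hf : Measurable[m] f) (hX : AEMeasurable X P) :
    condLExp m P (fun x => f x * X x) =ᵐ[P] fun x => f x * condLExp m P X x := by
  refine (ae_eq_condLExp hm P _ (hf.mul (measurable_condLExp m P X)) fun s hs => ?_).symm
  have hi : ∀ Y : Ω → ℝ≥0∞, ∫⁻ x in s, f x * Y x ∂P = ∫⁻ x, s.indicator f x * Y x ∂P := by
    intro Y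
    rw [← lintegral_indicator (hm s hs)]
    exact lintegral_congr fun x => by by_cases h : x ∈ s <;> simp [h]
  refine (hi _).trans (Eq.trans ?_ (hi _).symm)
  exact lintegral_mul_condLExp hm (hf.indicator hs) hX

theorem measurable_gCondExp (m : MeasurableSpace Ω) (P : Measure[mΩ] Ω) (X : Ω → ℝ) :
    Measurable[m] (gCondExp m P X) :=
  (measurable_condLExp m P _).ennreal_toReal.sub (measurable_condLExp m P _).ennreal_toReal

/-- `Y` is the conditional expectation of the possibly non-integrable `X` given `m`, in the sense
that `φ * X` is integrable with `E[φ * X | m] = φ * Y` for some strictly positive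
`m`-measurable weight `φ ≤ 1`. -/
def HasCondExp (m : MeasurableSpace Ω) {mΩ : MeasurableSpace Ω} (P : Measure[mΩ] Ω)
    (X Y : Ω → ℝ) : Prop :=
  ∃ φ : Ω → ℝ, Measurable[m] φ ∧ (∀ x, 0 < φ x ∧ φ x ≤ 1) ∧
    Integrable (fun x => φ x * X x) P ∧
    P[fun x => φ x * X x | m] =ᵐ[P] fun x => φ x * Y x

theorem condExp_bdd_mul (hm : m ≤ mΩ) {ψ : Ω → ℝ} (hψ : Measurable[m] ψ)
    (hb : ∀ x, |ψ x| ≤ 1) (hX : Integrable X P) :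
    Integrable (fun x => ψ x * X x) P ∧
      P[fun x => ψ x * X x | m] =ᵐ[P] fun x => ψ x * (P[X | m]) x := by
  have hi : Integrable (fun x => ψ x * X x) P :=
    hX.bdd_mul (hψ.mono hm le_rfl).aestronglyMeasurable (c := 1) (ae_of_all _ hb)
  exact ⟨hi, condExp_mul_of_stronglyMeasurable_left hψ.stronglyMeasurable hi hX⟩

/-- A weight witnessing `HasCondExp` may be multiplied by any `m`-measurable function bounded
by one. -/
theorem condExp_reweight (hm : m ≤ mΩ) {φ ψ : Ω → ℝ} (hψ : Measurable[m] ψ)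
    (hb : ∀ x, |ψ x| ≤ 1) (hi : Integrable (fun x => φ x * X x) P)
    (he : P[fun x => φ x * X x | m] =ᵐ[P] fun x => φ x * Y x) :
    Integrable (fun x => ψ x * (φ x * X x)) P ∧
      P[fun x => ψ x * (φ x * X x) | m] =ᵐ[P] fun x => ψ x * (φ x * Y x) := by
  obtain ⟨h1, h2⟩ := condExp_bdd_mul hm hψ hb hi
  refine ⟨h1, ?_⟩
  filter_upwards [h2, he] with x e1 e2
  rw [e1, e2]

/-- Two conditional expectations can be computed with a common weight. -/
theorem HasCondExp.common_weight (hm : m ≤ mΩ) (h : HasCondExp m P X Y)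
    (h' : HasCondExp m P X' Y') :
    ∃ φ : Ω → ℝ, Measurable[m] φ ∧ (∀ x, 0 < φ x ∧ φ x ≤ 1) ∧
      (Integrable (fun x => φ x * X x) P ∧
        P[fun x => φ x * X x | m] =ᵐ[P] fun x => φ x * Y x) ∧
      (Integrable (fun x => φ x * X' x) P ∧
        P[fun x => φ x * X' x | m] =ᵐ[P] fun x => φ x * Y' x) := by
  obtain ⟨φ, hφ, hφ1, hi, he⟩ := h
  obtain ⟨ψ, hψ, hψ1, hi', he'⟩ := h'
  refine ⟨fun x => ψ x * φ x, hψ.mul hφ, fun x => ⟨mul_pos (hψ1 x).1 (hφ1 x).1,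
    mul_le_one₀ (hψ1 x).2 (hφ1 x).1.le (hφ1 x).2⟩, ?_, ?_⟩
  · have := condExp_reweight hm hψ (fun x => by
      rw [abs_of_pos (hψ1 x).1]; exact (hψ1 x).2) hi he
    simpa only [mul_assoc] using this
  · have := condExp_reweight hm hφ (fun x => by
      rw [abs_of_pos (hφ1 x).1]; exact (hφ1 x).2) hi' he'
    simpa only [mul_assoc, mul_left_comm] using this

theorem HasCondExp.add (hm : m ≤ mΩ) (h : HasCondExp m P X Y) (h' : HasCondExp m P X' Y') :
    HasCondExp m P (fun x => X x + X' x) (fun x => Y x + Y' x) := by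
  obtain ⟨φ, hφ, hφ1, ⟨hi, he⟩, hi', he'⟩ := h.common_weight hm h'
  refine ⟨φ, hφ, hφ1, ?_, ?_⟩
  · simp only [mul_add]
    exact hi.add hi'
  · have := condExp_add hi hi' m
    simp only [mul_add]
    filter_upwards [this, he, he'] with x e1 e2 e3
    exact e1.trans (by rw [Pi.add_apply, e2, e3])

/-- Multiplying `X` by any `m`-measurable `Z` is allowed: the weight is divided by `1 + |Z|`. -/
theorem HasCondExp.mul_left (hm : m ≤ mΩ) (hZ : Measurable[m] Z) (h : HasCondExp m P X Y) :
    HasCondExp m P (fun x => Z x * X x) (fun x => Z x * Y x) := by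
  obtain ⟨φ, hφ, hφ1, hi, he⟩ := h
  have hpos : ∀ x, 0 < 1 + |Z x| := fun x => by positivity
  have hinv : Measurable[m] fun x => (1 + |Z x|)⁻¹ := 
    Measurable.comp (g := fun z : ℝ => (1 + |z|)⁻¹) (by fun_prop) hZ
  have hb : ∀ x, |(1 + |Z x|)⁻¹ * Z x| ≤ 1 := fun x => by
    rw [abs_mul, abs_of_pos (inv_pos.2 (hpos x)), inv_mul_le_one₀ (hpos x)]
    linarith
  obtain ⟨h1, h2⟩ := condExp_reweight hm (hinv.mul hZ) hb hi he
  have e : ∀ W : Ω → ℝ, (fun x => (1 + |Z x|)⁻¹ * φ x * (Z x * W x)) =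
      fun x => (1 + |Z x|)⁻¹ * Z x * (φ x * W x) := fun W => by funext x; ring
  refine ⟨fun x => (1 + |Z x|)⁻¹ * φ x, hinv.mul hφ, fun x => ⟨mul_pos (inv_pos.2 (hpos x))
    (hφ1 x).1, mul_le_one₀ (inv_le_one_of_one_le₀ (by linarith [abs_nonneg (Z x)]))
      (hφ1 x).1.le (hφ1 x).2⟩, ?_, ?_⟩
  · rw [e]; exact h1
  · rw [e, e]; exact h2

theorem HasCondExp.congr (h : HasCondExp m P X Y) (hX : X =ᵐ[P] X') (hY : Y =ᵐ[P] Y') :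
    HasCondExp m P X' Y' := by
  obtain ⟨φ, hφ, hφ1, hi, he⟩ := h
  have e : (fun x => φ x * X x) =ᵐ[P] fun x => φ x * X' x := by
    filter_upwards [hX] with x hx
    rw [hx]
  refine ⟨φ, hφ, hφ1, hi.congr e, ?_⟩
  filter_upwards [condExp_congr_ae (m := m) e, he, hY] with x e1 e2 e3
  rw [← e1, e2, e3]

theorem hasCondExp_of_integrable (h : Integrable X P) : HasCondExp m P X (P[X | m]) :=
  ⟨fun _ => 1, measurable_const, by simp, by simpa using h, by simp⟩

theorem HasCondExp.mono (hm : m ≤ mΩ) (h : HasCondExp m P X Y) (h' : HasCondExp m P X' Y')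
    (hle : X ≤ᵐ[P] X') : Y ≤ᵐ[P] Y' := by
  obtain ⟨φ, hφ, hφ1, ⟨hi, he⟩, hi', he'⟩ := h.common_weight hm h'
  have := condExp_mono (m := m) hi hi' (by
    filter_upwards [hle] with x hx
    exact mul_le_mul_of_nonneg_left hx (hφ1 x).1.le)
  filter_upwards [this, he, he'] with x e1 e2 e3
  rw [e2, e3] at e1
  exact le_of_mul_le_mul_left e1 (hφ1 x).1

theorem HasCondExp.unique (hm : m ≤ mΩ) (h : HasCondExp m P X Y) (h' : HasCondExp m P X Y') :
    Y =ᵐ[P] Y' :=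
  (h.mono hm h' Filter.EventuallyLE.rfl).antisymm (h'.mono hm h Filter.EventuallyLE.rfl)

theorem HasCondExp.aestronglyMeasurable (hm : m ≤ mΩ) (h : HasCondExp m P X Y) :
    AEStronglyMeasurable X P := by
  obtain ⟨φ, hφ, hφ1, hi, -⟩ := h
  refine (((hφ.inv.mono hm le_rfl).aestronglyMeasurable (μ := P)).mul
    hi.aestronglyMeasurable).congr (ae_of_all _ fun x => ?_)
  simp [(hφ1 x).1.ne']

theorem CondIntegrable.mono {X X' : Ω → ℝ} (h : CondIntegrable m P X')
    (hle : ∀ᵐ x ∂P, |X x| ≤ |X' x|) : CondIntegrable m P X := by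
  have := condLExp_mono (mΩ := m) (P := P) (X := fun y => ‖X y‖ₑ) (Y := fun y => ‖X' y‖ₑ)
    (hle.mono fun x hx => enorm_le_iff_norm_le.2 hx)
  filter_upwards [this, h] with x h1 h2
  exact h1.trans_lt h2

theorem condExp_ae_eq_of_hasCondExp (hm : m ≤ mΩ) (h : HasCondExp m P X Y)
    (hX : Integrable X P) : P[X | m] =ᵐ[P] Y :=
  (hasCondExp_of_integrable hX).unique hm h

variable [IsProbabilityMeasure P]

theorem hasCondExp_of_measurable (hm : m ≤ mΩ) (h : Measurable[m] X) : HasCondExp m P X X := by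
  have h1 : HasCondExp m P (fun _ => (1 : ℝ)) (fun _ => 1) := by
    refine (hasCondExp_of_integrable (integrable_const (1 : ℝ))).congr Filter.EventuallyEq.rfl ?_
    rw [condExp_const hm]
  simpa using h1.mul_left hm h

/-- Tower property: a variable `X` that is centred given the finer `m'` stays centred given `m`
after multiplication by an `m'`-measurable factor. -/
theorem HasCondExp.zero_of_le (hmm : m ≤ m') (hm' : m' ≤ mΩ) (hX : Integrable X P)
    (hX0 : P[X | m'] =ᵐ[P] 0) (hZ : Measurable[m'] Z)
    (h : HasCondExp m P (fun x => Z x * X x) Y) :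
    HasCondExp m P (fun x => Z x * X x) (fun _ => 0) := by
  obtain ⟨φ, hφ, hφ1, hi, -⟩ := h
  refine ⟨φ, hφ, hφ1, hi, ?_⟩
  have e : (fun x => φ x * (Z x * X x)) = (fun x => φ x * Z x) * X := by
    funext x
    simp only [Pi.mul_apply, mul_assoc]
  have h1 : P[fun x => φ x * (Z x * X x) | m'] =ᵐ[P] 0 := by
    rw [e] at hi ⊢
    filter_upwards [condExp_mul_of_stronglyMeasurable_left
      (((hφ.mono hmm le_rfl).mul hZ).stronglyMeasurable) hi hX, hX0] with x e1 e2
    refine e1.trans ?_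
    rw [Pi.mul_apply, e2]
    simp
  have h2 := condExp_condExp_of_le hmm hm' (f := fun x => φ x * (Z x * X x)) (μ := P)
  have h3 := condExp_congr_ae (m := m) h1
  rw [condExp_zero] at h3
  filter_upwards [h2, h3] with x e2 e3
  rw [← e2, e3]
  simp

theorem hasCondExp_zero_of_le (hmm : m ≤ m') (hm' : m' ≤ mΩ) (hX : Integrable X P)
    (hX0 : P[X | m'] =ᵐ[P] 0) : HasCondExp m P X (fun _ => 0) := by
  refine (hasCondExp_of_integrable hX).congr Filter.EventuallyEq.rfl ?_
  have h := condExp_congr_ae (m := m) hX0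
  rw [condExp_zero] at h
  exact (condExp_condExp_of_le hmm hm').symm.trans h

theorem HasCondExp.lintegral_eq (hm : m ≤ mΩ) (h : HasCondExp m P X Y) (h0 : 0 ≤ᵐ[P] X) :
    ∫⁻ x, ENNReal.ofReal (X x) ∂P = ∫⁻ x, ENNReal.ofReal (Y x) ∂P := by
  obtain ⟨φ, hφ, hφ1, hi, he⟩ := h
  have h1 := condLExp_ofReal m hi (by
    filter_upwards [h0] with x hx
    exact mul_nonneg (hφ1 x).1.le hx)
  have e : ∀ W : Ω → ℝ, ∀ x, ENNReal.ofReal (W x) =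
      ENNReal.ofReal (φ x)⁻¹ * ENNReal.ofReal (φ x * W x) := fun W x => by
    rw [← ENNReal.ofReal_mul (inv_nonneg.2 (hφ1 x).1.le), inv_mul_cancel_left₀ (hφ1 x).1.ne']
  rw [lintegral_congr (e X), lintegral_congr (e Y)]
  refine (lintegral_mul_condLExp hm hφ.inv.ennreal_ofReal
      hi.aestronglyMeasurable.aemeasurable.ennreal_ofReal).symm.trans (lintegral_congr_ae ?_)
  filter_upwards [h1, he] with x e1 e2
  simp only [e1, e2, Pi.inv_apply]

/-- A nonnegative variable whose conditional expectation has an integrable upper bound is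
integrable. -/
theorem HasCondExp.integrable (hm : m ≤ mΩ) (h : HasCondExp m P X Y) (h0 : 0 ≤ᵐ[P] X)
    (hZ : Integrable Z P) (hle : Y ≤ᵐ[P] Z) : Integrable X P := by
  refine ⟨h.aestronglyMeasurable hm, ?_⟩
  rw [hasFiniteIntegral_iff_ofReal h0, h.lintegral_eq hm h0]
  exact (lintegral_mono_ae (hle.mono fun x hx => ENNReal.ofReal_le_ofReal hx)).trans_lt
    hZ.lintegral_lt_top

theorem HasCondExp.condIntegrable (hm : m ≤ mΩ) (h : HasCondExp m P X Y) :
    CondIntegrable m P X := by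
  have hX := h.aestronglyMeasurable hm
  obtain ⟨φ, hφ, hφ1, hi, he⟩ := h
  have h1 := condLExp_mul_left (P := P) hm hφ.ennreal_ofReal hX.enorm
  have h2 : ∀ᵐ x ∂P, condLExp m P (fun x => ‖φ x * X x‖ₑ) x < ∞ :=
    condLExp_lt_top hi.hasFiniteIntegral.ne
  have e : (fun x => ‖φ x * X x‖ₑ) = fun x => ENNReal.ofReal (φ x) * ‖X x‖ₑ := by
    funext x
    rw [enorm_mul, Real.enorm_of_nonneg (hφ1 x).1.le]
  rw [e] at h2
  filter_upwards [h1, h2] with x e1 e2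
  rw [e1] at e2
  by_contra hx
  rw [not_lt, top_le_iff] at hx
  rw [hx, ENNReal.mul_top (by simpa using (hφ1 x).1)] at e2
  exact lt_irrefl _ e2

theorem gCondExp_mul_left (hm : m ≤ mΩ) (hX : AEStronglyMeasurable X P) (hZ : Measurable[m] Z)
    (hZ0 : ∀ x, 0 ≤ Z x) :
    gCondExp m P (fun x => Z x * X x) =ᵐ[P] fun x => Z x * gCondExp m P X x := by
  have h1 := condLExp_mul_left (P := P) hm hZ.ennreal_ofReal hX.aemeasurable.ennreal_ofReal
  have h2 := condLExp_mul_left (P := P) hm hZ.ennreal_ofReal hX.aemeasurable.neg.ennreal_ofReal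
  have e1 : (fun y => ENNReal.ofReal (Z y * X y)) =
      fun y => ENNReal.ofReal (Z y) * ENNReal.ofReal (X y) := by
    funext y; rw [ENNReal.ofReal_mul (hZ0 y)]
  have e2 : (fun y => ENNReal.ofReal (-(Z y * X y))) =
      fun y => ENNReal.ofReal (Z y) * ENNReal.ofReal ((-X) y) := by
    funext y; rw [← ENNReal.ofReal_mul (hZ0 y)]; simp
  filter_upwards [h1, h2] with x h1 h2
  simp only [gCondExp, e1, e2]
  rw [h1, h2, ENNReal.toReal_mul, ENNReal.toReal_mul, ENNReal.toReal_ofReal (hZ0 x), mul_sub]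
  rfl

/-- The weight `1 / (1 + E[|X| | m])` makes a conditionally integrable variable integrable. -/
theorem CondIntegrable.hasCondExp (hm : m ≤ mΩ) (hX : AEStronglyMeasurable X P)
    (h : CondIntegrable m P X) : HasCondExp m P X (gCondExp m P X) := by
  set a : Ω → ℝ≥0∞ := condLExp m P (fun y => ‖X y‖ₑ)
  have ha : Measurable[m] a := measurable_condLExp m P _
  have hpos : ∀ x, 0 < 1 + (a x).toReal := fun x => by positivity
  have hφ : Measurable[m] fun x => (1 + (a x).toReal)⁻¹ :=
    (measurable_const.add ha.ennreal_toReal).inv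
  have hi : Integrable (fun x => (1 + (a x).toReal)⁻¹ * X x) P := by
    refine ⟨(hφ.mono hm le_rfl).aestronglyMeasurable.mul hX, ?_⟩
    have e : ∀ x, ‖(1 + (a x).toReal)⁻¹ * X x‖ₑ =
        ENNReal.ofReal ((1 + (a x).toReal)⁻¹) * ‖X x‖ₑ := fun x => by
      rw [enorm_mul, Real.enorm_of_nonneg (inv_nonneg.2 (hpos x).le)]
    rw [HasFiniteIntegral, lintegral_congr e, ← lintegral_mul_condLExp hm hφ.ennreal_ofReal
      hX.enorm]
    refine lt_of_le_of_lt (lintegral_mono_ae (g := fun _ => 1) ?_) (by simp)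
    filter_upwards [h] with x hx
    change ENNReal.ofReal ((1 + (a x).toReal)⁻¹) * a x ≤ 1
    nth_rewrite 2 [← ENNReal.ofReal_toReal (a := a x) hx.ne]
    rw [← ENNReal.ofReal_mul (inv_nonneg.2 (hpos x).le), ← ENNReal.ofReal_one]
    refine ENNReal.ofReal_le_ofReal ?_
    rw [inv_mul_le_one₀ (hpos x)]
    linarith
  refine ⟨fun x => (1 + (a x).toReal)⁻¹, hφ, fun x => ⟨inv_pos.2 (hpos x),
    inv_le_one_of_one_le₀ (by linarith [ENNReal.toReal_nonneg (a := a x)])⟩, hi, ?_⟩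
  exact (gCondExp_ae_eq_condExp hi).symm.trans
    (gCondExp_mul_left hm hX hφ fun x => inv_nonneg.2 (hpos x).le)

theorem HasCondExp.of_abs_le (hm : m ≤ mΩ) (h : HasCondExp m P X' Y')
    (hX : AEStronglyMeasurable X P) (hle : ∀ᵐ x ∂P, |X x| ≤ X' x) :
    HasCondExp m P X (gCondExp m P X) :=
  ((h.condIntegrable hm).mono (hle.mono fun _ hx => hx.trans (le_abs_self _))).hasCondExp hm hX

/-- If `X` is conditionally integrable given `m` and `A ≥ 0` has bounded conditional expectation
given the finer `m'`, then `X * A` is conditionally integrable for `m'`-measurable `X ≥ 0`. -/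
theorem CondIntegrable.mul_of_condExp_le (hmm : m ≤ m') (hm' : m' ≤ mΩ) {A : Ω → ℝ} {κ : ℝ}
    (hX : Measurable[m'] X) (hX0 : ∀ x, 0 ≤ X x) (hXi : CondIntegrable m P X)
    (hA : Integrable A P) (hA0 : 0 ≤ᵐ[P] A) (hκ : ∀ᵐ x ∂P, (P[A | m']) x ≤ κ) :
    HasCondExp m P (fun x => X x * A x) (gCondExp m P (fun x => X x * A x)) := by
  have hm := hmm.trans hm'
  have hXae : AEStronglyMeasurable X P := (hX.mono hm' le_rfl).aestronglyMeasurable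
  obtain ⟨φ, hφ, hφ1, hi, -⟩ := hXi.hasCondExp hm hXae
  refine CondIntegrable.hasCondExp hm (hXae.mul hA.aestronglyMeasurable) ?_
  refine HasCondExp.condIntegrable (Y := fun x => (φ x)⁻¹ * (P[fun x => φ x * (X x * A x) | m]) x)
    hm ⟨φ, hφ, hφ1, ?_, ae_of_all _ fun x =>
      (mul_inv_cancel_left₀ (hφ1 x).1.ne' _).symm⟩
  have hf : Measurable[m'] fun x => φ x * X x := (hφ.mono hmm le_rfl).mul hX
  have hf0 : ∀ x, 0 ≤ φ x * X x := fun x => mul_nonneg (hφ1 x).1.le (hX0 x)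
  refine HasCondExp.integrable (Y := fun x => φ x * X x * (P[A | m']) x)
    (Z := fun x => κ * (φ x * X x)) hm' ?_ ?_ (hi.const_mul κ) ?_
  · simpa only [mul_assoc] using (hasCondExp_of_integrable hA).mul_left hm' hf
  · filter_upwards [hA0] with x hx
    exact mul_nonneg (hφ1 x).1.le (mul_nonneg (hX0 x) hx)
  · filter_upwards [hκ] with x hx
    rw [mul_comm κ]
    exact mul_le_mul_of_nonneg_left hx (hf0 x)

end CondExp

/-! ### One step of the backward recursion -/

section OneStep

variable {Ω : Type*} {m m' mΩ : MeasurableSpace Ω} {P : Measure[mΩ] Ω} [IsProbabilityMeasure P]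

theorem HasCondExp.of_sq_le (hm : m ≤ mΩ) {Y K U k u : Ω → ℝ} (hY : AEStronglyMeasurable Y P)
    (hK : HasCondExp m P K k) (hU : HasCondExp m P U u)
    (h : ∀ᵐ x ∂P, 0 ≤ K x ∧ 0 ≤ U x ∧ Y x ^ 2 ≤ K x * U x) :
    HasCondExp m P Y (gCondExp m P Y) := by
  refine (hK.add hm hU).of_abs_le hm hY ?_
  filter_upwards [h] with x ⟨h1, h2, h3⟩
  exact abs_le_of_sq_le_sq (by nlinarith) (by linarith)

/-- If `Y ^ 2 ≤ K * U`, then `Y` vanishes almost surely where `E[U | m]` does, and so does its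
conditional expectation. -/
theorem HasCondExp.eq_zero_of_sq_le (hm : m ≤ mΩ) {Y K U y u : Ω → ℝ}
    (hY : HasCondExp m P Y y) (hU : HasCondExp m P U u) (hu : Measurable[m] u)
    (h : ∀ᵐ x ∂P, 0 ≤ U x ∧ Y x ^ 2 ≤ K x * U x) :
    ∀ᵐ x ∂P, u x = 0 → y x = 0 := by
  have hs : MeasurableSet[m] (u ⁻¹' {0}) := hu (measurableSet_singleton 0)
  set Z : Ω → ℝ := (u ⁻¹' {0}).indicator fun _ => 1
  have hZ : Measurable[m] Z := measurable_const.indicator hs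
  have hZ0 : ∀ x, 0 ≤ Z x := fun x => Set.indicator_nonneg (fun _ _ => zero_le_one) x
  have hZu : ∀ x, Z x * u x = 0 := fun x => by
    by_cases hx : u x = 0 <;> simp [Z, hx]
  have h1 := hU.mul_left hm hZ
  have h2 := h1.lintegral_eq hm (by
    filter_upwards [h] with x hx
    exact mul_nonneg (hZ0 x) hx.1)
  simp only [hZu, ENNReal.ofReal_zero, lintegral_zero] at h2
  rw [lintegral_eq_zero_iff' (h1.aestronglyMeasurable hm).aemeasurable.ennreal_ofReal] at h2
  have h3 : (fun x => Z x * Y x) =ᵐ[P] fun _ => 0 := by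
    filter_upwards [h, h2] with x ⟨e1, e2⟩ e3
    -- `ENNReal.ofReal` vanishes exactly at the nonpositive numbers.
    have e4 : Z x * U x ≤ 0 := by simpa using e3
    by_cases hx : u x = 0
    · have hz : Z x = 1 := by simp [Z, hx]
      have e5 : U x = 0 := by rw [hz] at e4; linarith
      rw [e5, mul_zero] at e2
      rw [pow_eq_zero_iff two_ne_zero |>.1 (le_antisymm e2 (sq_nonneg _)), mul_zero]
    · simp [Z, hx]
  have h4 := ((hY.mul_left hm hZ).congr h3 Filter.EventuallyEq.rfl).unique hm
    (hasCondExp_of_measurable hm measurable_const)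
  filter_upwards [h4] with x hx h0
  simpa [Z, h0] using hx

/-- The tower property lets one replace `U` by `V` under the coarser conditional expectation as
soon as `E[U - V | m'] = 0`. -/
theorem HasCondExp.replace (hmm : m ≤ m') (hm' : m' ≤ mΩ) {Z U V a b : Ω → ℝ}
    (hUV : Integrable (fun x => U x - V x) P) (h0 : P[fun x => U x - V x | m'] =ᵐ[P] 0)
    (hZ : Measurable[m'] Z) (hU : HasCondExp m P (fun x => Z x * U x) a)
    (hV : HasCondExp m P (fun x => Z x * V x) b) :
    HasCondExp m P (fun x => Z x * U x) b ∧
      HasCondExp m P (fun x => Z x * (U x - V x)) (fun _ => 0) := by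
  have hm := hmm.trans hm'
  have h1 := hU.add hm (hV.mul_left hm (Z := fun _ => -1) measurable_const)
  have h2 : HasCondExp m P (fun x => Z x * (U x - V x)) (fun _ => 0) :=
    HasCondExp.zero_of_le hmm hm' hUV h0 hZ
      (h1.congr (ae_of_all _ fun x => by ring) Filter.EventuallyEq.rfl)
  exact ⟨(h2.add hm hV).congr (ae_of_all _ fun x => by ring) (ae_of_all _ fun x => by ring), h2⟩

/-- The properties, given the information `m` at some time, of the two sums
`A = ∑ w i * D i ^ 2` and `B = ∑ w i * D i` over the later times `i`, where `D` is the
discounting product: `A` has bounded conditional expectation, equal to that of `B`. -/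
structure IsUnitTail (m : MeasurableSpace Ω) {mΩ : MeasurableSpace Ω} (P : Measure[mΩ] Ω)
    (A B : Ω → ℝ) : Prop where
  integrable_left : Integrable A P
  integrable_right : Integrable B P
  nonneg : 0 ≤ᵐ[P] A
  bound : ∃ κ : ℝ, ∀ᵐ x ∂P, (P[A | m]) x ≤ κ
  balanced : P[fun x => A x - B x | m] =ᵐ[P] 0

/-- The conditional moments that enter one backward step with increment `X`: the coefficients
`a = E[X * A | m]` and `d = E[X ^ 2 * A | m]`, and a solution `b` of `b * d = a`. -/
structure StepCoeff (m : MeasurableSpace Ω) {mΩ : MeasurableSpace Ω} (P : Measure[mΩ] Ω)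
    (X A B a b d : Ω → ℝ) : Prop where
  hasCondExp_sq : HasCondExp m P (fun x => X x ^ 2 * A x) d
  hasCondExp_mul : HasCondExp m P (fun x => X x * A x) a
  hasCondExp_mul_right : HasCondExp m P (fun x => X x * B x) a
  hasCondExp_sub : HasCondExp m P (fun x => X x * (A x - B x)) (fun _ => 0)
  d_measurable : Measurable[m] d
  b_measurable : Measurable[m] b
  d_nonneg : 0 ≤ᵐ[P] d
  degenerate : ∀ᵐ x ∂P, d x = 0 → a x = 0
  mul_eq : ∀ᵐ x ∂P, b x * d x = a x

theorem IsUnitTail.stepCoeff (hmm : m ≤ m') (hm' : m' ≤ mΩ) {X A B b : Ω → ℝ} {c : ℝ}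
    (h : IsUnitTail m' P A B) (hX : Measurable[m'] X)
    (hX2 : CondIntegrable m P fun x => X x ^ 2) (hc : 0 ≤ c)
    (hB : ∀ᵐ x ∂P, B x ^ 2 ≤ c * A x)
    (hb : ∀ x, b x = gCondExp m P (fun x => X x * B x) x /
      gCondExp m P (fun x => X x ^ 2 * A x) x) :
    StepCoeff m P X A B (gCondExp m P fun x => X x * B x) b
      (gCondExp m P fun x => X x ^ 2 * A x) := by
  have hm := hmm.trans hm'
  have hXae : AEStronglyMeasurable X P := (hX.mono hm' le_rfl).aestronglyMeasurable
  obtain ⟨κ, hκ⟩ := h.bound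
  have hd : HasCondExp m P (fun x => X x ^ 2 * A x) (gCondExp m P fun x => X x ^ 2 * A x) :=
    CondIntegrable.mul_of_condExp_le hmm hm' (hX.pow_const 2) (fun x => sq_nonneg _) hX2
      h.integrable_left h.nonneg hκ
  have hsq : ∀ᵐ x ∂P, 0 ≤ c ∧ 0 ≤ X x ^ 2 * A x ∧
      (X x * B x) ^ 2 ≤ c * (X x ^ 2 * A x) := by
    filter_upwards [h.nonneg, hB] with x h0 h1
    refine ⟨hc, mul_nonneg (sq_nonneg _) h0, ?_⟩
    nlinarith [mul_le_mul_of_nonneg_left h1 (sq_nonneg (X x))]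
  have ha : HasCondExp m P (fun x => X x * B x) (gCondExp m P fun x => X x * B x) :=
    HasCondExp.of_sq_le hm (hXae.mul h.integrable_right.aestronglyMeasurable)
      (hasCondExp_of_measurable hm measurable_const) hd hsq
  have hA : HasCondExp m P (fun x => X x * A x) (gCondExp m P fun x => X x * A x) := by
    refine ((hasCondExp_of_integrable h.integrable_left).add hm hd).of_abs_le hm
      (hXae.mul h.integrable_left.aestronglyMeasurable) ?_
    filter_upwards [h.nonneg] with x (h0 : 0 ≤ A x)
    rw [abs_mul, abs_of_nonneg h0]
    nlinarith [mul_nonneg h0 (sq_nonneg (|X x| - 1)), sq_abs (X x),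
      mul_nonneg h0 (sq_nonneg (X x))]
  have hsub : Integrable (fun x => A x - B x) P := h.integrable_left.sub h.integrable_right
  obtain ⟨h1, h2⟩ := HasCondExp.replace hmm hm' hsub h.balanced hX hA ha
  have hmeas := measurable_gCondExp m P fun x => X x ^ 2 * A x
  have hdeg := HasCondExp.eq_zero_of_sq_le hm ha hd hmeas (hsq.mono fun x hx => hx.2)
  refine ⟨hd, h1, ha, h2, hmeas, ?_, ?_, hdeg, ?_⟩
  · have e : b = fun x => gCondExp m P (fun x => X x * B x) x /
      gCondExp m P (fun x => X x ^ 2 * A x) x := funext hb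
    rw [e]
    exact (measurable_gCondExp m P _).div hmeas
  · exact (hasCondExp_of_measurable hm measurable_const).mono hm hd (hsq.mono fun x hx => hx.2.1)
  · -- Where the denominator vanishes so does the numerator, so the junk value `0 / 0 = 0` is harmless.
    filter_upwards [hdeg] with x hx
    rw [hb]
    by_cases h0 : gCondExp m P (fun x => X x ^ 2 * A x) x = 0
    · rw [hx h0, h0, mul_zero]
    · exact div_mul_cancel₀ _ h0

/-- The choice of `b` lowers the conditional expectation of `(1 - b * X) ^ 2 * A` below that of
`A`, which keeps it bounded. -/
theorem IsUnitTail.step (hmm : m ≤ m') (hm' : m' ≤ mΩ) {X A B a b d w A' B' : Ω → ℝ} {c : ℝ}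
    (h : IsUnitTail m' P A B) (hs : StepCoeff m P X A B a b d)
    (hw : Measurable[m] w) (hw01 : ∀ᵐ x ∂P, w x ∈ Set.Icc (0 : ℝ) 1) (hc : 0 ≤ c)
    (hA' : ∀ x, A' x = w x + (1 - b x * X x) ^ 2 * A x)
    (hB' : ∀ x, B' x = w x + (1 - b x * X x) * B x)
    (hBm : AEStronglyMeasurable B' P) (hBA : ∀ᵐ x ∂P, B' x ^ 2 ≤ c * A' x) :
    IsUnitTail m P A' B' := by
  have hm := hmm.trans hm'
  obtain ⟨κ, hκ⟩ := h.bound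
  have hb := hs.b_measurable
  have hwH : HasCondExp m P w w := hasCondExp_of_measurable hm hw
  have hAm := hasCondExp_of_integrable (m := m) h.integrable_left
  have hκ' : ∀ᵐ x ∂P, (P[A | m]) x ≤ κ := by
    have h1 := condExp_condExp_of_le (f := A) (μ := P) hmm hm'
    have h2 := condExp_mono (m := m) (integrable_condExp (m := m') (f := A) (μ := P))
      (integrable_const κ) hκ
    rw [condExp_const hm] at h2
    filter_upwards [h1, h2] with x e1 e2
    rwa [e1] at e2
  have hA'H : HasCondExp m P A' fun x => w x + ((P[A | m]) x - b x * a x) := by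
    have := (hwH.add hm hAm).add hm (((hs.hasCondExp_mul.mul_left hm hb).mul_left hm
      (Z := fun _ => -2) measurable_const).add hm
        (hs.hasCondExp_sq.mul_left hm (hb.pow_const 2)))
    refine this.congr (ae_of_all _ fun x => ?_) ?_
    · rw [hA']; ring
    · filter_upwards [hs.mul_eq] with x hx
      rw [← hx]; ring
  have h0 : 0 ≤ᵐ[P] A' := by
    filter_upwards [hw01, h.nonneg] with x h1 h2
    rw [hA']
    exact add_nonneg h1.1 (mul_nonneg (sq_nonneg _) h2)
  have hle : ∀ᵐ x ∂P, w x + ((P[A | m]) x - b x * a x) ≤ 1 + κ := by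
    filter_upwards [hw01, hκ', hs.mul_eq, hs.d_nonneg] with x h1 h2 h3 (h4 : 0 ≤ d x)
    have h5 : 0 ≤ b x * a x := by
      rw [← h3, ← mul_assoc, ← sq]
      exact mul_nonneg (sq_nonneg _) h4
    have := h1.2
    linarith
  have hAi : Integrable A' P := hA'H.integrable hm h0 (integrable_const (1 + κ)) hle
  have hBi : Integrable B' P := by
    refine Integrable.mono' ((integrable_const c).add hAi) hBm ?_
    filter_upwards [hBA, h0] with x h1 (h2 : 0 ≤ A' x)
    rw [Real.norm_eq_abs, Pi.add_apply]
    exact abs_le_of_sq_le_sq (by nlinarith) (by linarith)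
  refine ⟨hAi, hBi, h0, ⟨1 + κ, ?_⟩, ?_⟩
  · filter_upwards [condExp_ae_eq_of_hasCondExp hm hA'H hAi, hle] with x h1 h2
    rwa [h1]
  · -- `A' - B' = (A - B) - b X (A - B) - b X A + b² X² A`, where the first two terms are centred
    -- and the last two cancel in conditional expectation because `b * d = a`.
    have hE : HasCondExp m P (fun x => A x - B x) fun _ => 0 :=
      hasCondExp_zero_of_le hmm hm' (h.integrable_left.sub h.integrable_right) h.balanced
    refine condExp_ae_eq_of_hasCondExp hm ?_ (hAi.sub hBi)
    have := (hE.add hm ((hs.hasCondExp_sub.mul_left hm hb).mul_left hm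
      (Z := fun _ => -1) measurable_const)).add hm
        (((hs.hasCondExp_mul.mul_left hm hb).mul_left hm
          (Z := fun _ => -1) measurable_const).add hm
        (hs.hasCondExp_sq.mul_left hm (hb.pow_const 2)))
    refine this.congr (ae_of_all _ fun x => ?_) ?_
    · simp only [hA', hB']; ring
    · filter_upwards [hs.mul_eq] with x hx
      simp only [Pi.zero_apply]
      rw [← hx]; ring

/-- The properties, given the information `m` at some time, of the quadratic
`u ↦ L - 2 * u * Q + u ^ 2 * A`, the remaining quadratic cost of the optimal strategy started
from wealth `u`, and of `C = ∑ H i * w i * D i`, which is dominated through `C ^ 2 ≤ K * A` and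
has the same conditional expectation as `Q`. -/
structure IsCostTail (m : MeasurableSpace Ω) {mΩ : MeasurableSpace Ω} (P : Measure[mΩ] Ω)
    (A C L Q : Ω → ℝ) : Prop where
  integrable_const : Integrable L P
  integrable_linear : Integrable Q P
  integrable_right : Integrable C P
  nonneg : ∀ᵐ x ∂P, ∀ u : ℝ, 0 ≤ L x - 2 * u * Q x + u ^ 2 * A x
  balanced : P[fun x => C x - Q x | m] =ᵐ[P] 0

/-- Nonnegativity of the cost as a quadratic in the wealth is the Cauchy-Schwarz inequality. -/
theorem sq_le_of_quadratic_nonneg {l q a : ℝ} (h : ∀ u : ℝ, 0 ≤ l - 2 * u * q + u ^ 2 * a) :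
    q ^ 2 ≤ l * a := by
  have := discrim_le_zero (a := a) (b := -2 * q) (c := l) fun u => by
    have := h u
    nlinarith
  rw [discrim] at this
  linarith

/-- The conditional moments of the claim that enter one backward step with increment `X`: the
coefficient `e = E[X * Q | m] = E[X * C | m]`, and a solution `r` of `r * d = e`, where
`d = E[X ^ 2 * A | m]`. -/
structure CostCoeff (m : MeasurableSpace Ω) {mΩ : MeasurableSpace Ω} (P : Measure[mΩ] Ω)
    (X C Q d e r : Ω → ℝ) : Prop where
  hasCondExp_mul : HasCondExp m P (fun x => X x * Q x) e
  hasCondExp_mul_right : HasCondExp m P (fun x => X x * C x) e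
  hasCondExp_sub : HasCondExp m P (fun x => X x * (C x - Q x)) (fun _ => 0)
  r_measurable : Measurable[m] r
  degenerate : ∀ᵐ x ∂P, d x = 0 → e x = 0
  mul_eq : ∀ᵐ x ∂P, r x * d x = e x

theorem IsCostTail.costCoeff (hmm : m ≤ m') (hm' : m' ≤ mΩ) {X A B C L Q K a b d r : Ω → ℝ}
    (hA : IsUnitTail m' P A B) (h : IsCostTail m' P A C L Q)
    (hs : StepCoeff m P X A B a b d) (hX : Measurable[m'] X)
    (hK : Integrable K P) (hK0 : 0 ≤ᵐ[P] K) (hC : ∀ᵐ x ∂P, C x ^ 2 ≤ K x * A x)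
    (hr : ∀ x, r x = gCondExp m P (fun x => X x * C x) x / d x) :
    CostCoeff m P X C Q d (gCondExp m P fun x => X x * C x) r := by
  have hm := hmm.trans hm'
  have hXae : AEStronglyMeasurable X P := (hX.mono hm' le_rfl).aestronglyMeasurable
  have hsq : ∀ᵐ x ∂P, 0 ≤ K x ∧ 0 ≤ X x ^ 2 * A x ∧
      (X x * C x) ^ 2 ≤ K x * (X x ^ 2 * A x) := by
    filter_upwards [hA.nonneg, hC, hK0] with x h0 h1 h2
    refine ⟨h2, mul_nonneg (sq_nonneg _) h0, ?_⟩
    nlinarith [mul_le_mul_of_nonneg_left h1 (sq_nonneg (X x))]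
  have hsqQ : ∀ᵐ x ∂P, 0 ≤ L x ∧ 0 ≤ X x ^ 2 * A x ∧
      (X x * Q x) ^ 2 ≤ L x * (X x ^ 2 * A x) := by
    filter_upwards [hA.nonneg, h.nonneg] with x h0 h1
    refine ⟨by simpa using h1 0, mul_nonneg (sq_nonneg _) h0, ?_⟩
    nlinarith [mul_le_mul_of_nonneg_left (sq_le_of_quadratic_nonneg h1) (sq_nonneg (X x))]
  have he : HasCondExp m P (fun x => X x * C x) (gCondExp m P fun x => X x * C x) :=
    HasCondExp.of_sq_le hm (hXae.mul h.integrable_right.aestronglyMeasurable)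
      (hasCondExp_of_integrable hK) hs.hasCondExp_sq hsq
  have hQ : HasCondExp m P (fun x => X x * Q x) (gCondExp m P fun x => X x * Q x) :=
    HasCondExp.of_sq_le hm (hXae.mul h.integrable_linear.aestronglyMeasurable)
      (hasCondExp_of_integrable h.integrable_const) hs.hasCondExp_sq hsqQ
  obtain ⟨h1, h2⟩ := HasCondExp.replace hmm hm'
    (h.integrable_right.sub h.integrable_linear) h.balanced hX he hQ
  have hdeg := HasCondExp.eq_zero_of_sq_le hm he hs.hasCondExp_sq hs.d_measurable
    (hsq.mono fun x hx => hx.2)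
  refine ⟨hQ.congr Filter.EventuallyEq.rfl (h1.unique hm he), he, h2, ?_, hdeg, ?_⟩
  · rw [funext hr]
    exact (measurable_gCondExp m P _).div hs.d_measurable
  · filter_upwards [hdeg] with x hx
    rw [hr]
    by_cases h0 : d x = 0
    · rw [hx h0, h0, mul_zero]
    · exact div_mul_cancel₀ _ h0

omit [IsProbabilityMeasure P] in
/-- The conditional expectation of the remaining cost after holding `ξ` from wealth `v`. -/
theorem hasCondExp_cost (hm : m ≤ mΩ) {X A B C L Q a b d e r v ξ : Ω → ℝ}
    (hs : StepCoeff m P X A B a b d) (hr : CostCoeff m P X C Q d e r)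
    (hA : Integrable A P) (hL : Integrable L P) (hQ : Integrable Q P)
    (hv : Measurable[m] v) (hξ : Measurable[m] ξ) :
    HasCondExp m P
      (fun x => L x - 2 * (v x + ξ x * X x) * Q x + (v x + ξ x * X x) ^ 2 * A x)
      (fun x => (P[L | m]) x - 2 * v x * (P[Q | m]) x + v x ^ 2 * (P[A | m]) x -
        2 * ξ x * (e x - v x * a x) + ξ x ^ 2 * d x) := by
  have := (((hasCondExp_of_integrable hL).add hm
    ((hasCondExp_of_integrable (m := m) hQ).mul_left hm (hv.const_mul (-2)))).add hm
    ((hasCondExp_of_integrable (m := m) hA).mul_left hm (hv.pow_const 2))).add hm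
    (((hr.hasCondExp_mul.mul_left hm (hξ.const_mul (-2))).add hm
      (hs.hasCondExp_mul.mul_left hm ((hv.mul hξ).const_mul 2))).add hm
      (hs.hasCondExp_sq.mul_left hm (hξ.pow_const 2)))
  exact this.congr (ae_of_all _ fun x => by simp only [Pi.mul_apply]; ring)
    (ae_of_all _ fun x => by simp only [Pi.mul_apply]; ring)

/-- Among all holdings `ξ` from wealth `v`, the holding `r - b * v` minimises the remaining cost:
the conditional costs differ by `d * (ξ - (r - b * v)) ^ 2`. -/
theorem lintegral_cost_le (hm : m ≤ mΩ) {X A B C L Q a b d e r v ξ : Ω → ℝ}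
    (hs : StepCoeff m P X A B a b d) (hr : CostCoeff m P X C Q d e r)
    (hA : Integrable A P) (hL : Integrable L P) (hQ : Integrable Q P)
    (h0 : ∀ᵐ x ∂P, ∀ u : ℝ, 0 ≤ L x - 2 * u * Q x + u ^ 2 * A x)
    (hv : Measurable[m] v) (hξ : Measurable[m] ξ) :
    ∫⁻ x, ENNReal.ofReal (L x - 2 * (v x + (r x - b x * v x) * X x) * Q x +
        (v x + (r x - b x * v x) * X x) ^ 2 * A x) ∂P ≤
      ∫⁻ x, ENNReal.ofReal (L x - 2 * (v x + ξ x * X x) * Q x +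
        (v x + ξ x * X x) ^ 2 * A x) ∂P := by
  have hξs : Measurable[m] fun x => r x - b x * v x :=
    hr.r_measurable.sub (hs.b_measurable.mul hv)
  rw [(hasCondExp_cost hm hs hr hA hL hQ hv hξs).lintegral_eq hm (h0.mono fun x hx => hx _),
    (hasCondExp_cost hm hs hr hA hL hQ hv hξ).lintegral_eq hm (h0.mono fun x hx => hx _)]
  refine lintegral_mono_ae ?_
  filter_upwards [hs.mul_eq, hr.mul_eq, hs.d_nonneg] with x h1 h2 (h3 : 0 ≤ d x)
  refine ENNReal.ofReal_le_ofReal ?_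
  rw [← h1, ← h2]
  nlinarith [mul_nonneg h3 (sq_nonneg (ξ x - (r x - b x * v x)))]

/-- One backward step for the cost: `E[L' | m] = w * H ^ 2 + E[L | m] - r ^ 2 * d`, so `L'` stays
integrable, and the centring of `C - Q` is inherited. -/
theorem IsCostTail.step (hmm : m ≤ m') (hm' : m' ≤ mΩ)
    {X A B C L Q a b d e r w H A' C' L' Q' K' : Ω → ℝ}
    (hA : IsUnitTail m' P A B) (h : IsCostTail m' P A C L Q)
    (hs : StepCoeff m P X A B a b d) (hr : CostCoeff m P X C Q d e r)
    (hw : Measurable[m] w) (hw01 : ∀ᵐ x ∂P, w x ∈ Set.Icc (0 : ℝ) 1)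
    (hH : Measurable[m] H) (hwH : Integrable (fun x => w x * H x ^ 2) P)
    (hA' : ∀ x, A' x = w x + (1 - b x * X x) ^ 2 * A x) (hAi : Integrable A' P)
    (hC' : ∀ x, C' x = H x * w x + (1 - b x * X x) * C x)
    (hCm : AEStronglyMeasurable C' P) (hK : Integrable K' P) (hK0 : 0 ≤ᵐ[P] K')
    (hCA : ∀ᵐ x ∂P, C' x ^ 2 ≤ K' x * A' x)
    (hL' : ∀ x, L' x = w x * H x ^ 2 +
      (L x - 2 * (r x * X x) * Q x + (r x * X x) ^ 2 * A x))
    (hQ' : ∀ x, Q' x = w x * H x + (1 - b x * X x) * (Q x - r x * X x * A x)) :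
    IsCostTail m P A' C' L' Q' := by
  have hm := hmm.trans hm'
  have hb := hs.b_measurable
  have hrm := hr.r_measurable
  -- The recursions for `L'`, `Q'`, `A'` say that the cost from wealth `u` is the current cost
  -- plus the later cost from the wealth reached by holding `r - b * u`.
  have hrec : ∀ x u, L' x - 2 * u * Q' x + u ^ 2 * A' x = w x * (H x - u) ^ 2 +
      (L x - 2 * (u + (r x - b x * u) * X x) * Q x +
        (u + (r x - b x * u) * X x) ^ 2 * A x) := fun x u => by
    rw [hL', hQ', hA']; ring
  have hnn : ∀ᵐ x ∂P, ∀ u : ℝ, 0 ≤ L' x - 2 * u * Q' x + u ^ 2 * A' x := by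
    filter_upwards [h.nonneg, hw01] with x h1 h2 u
    rw [hrec]
    exact add_nonneg (mul_nonneg h2.1 (sq_nonneg _)) (h1 _)
  have hA0' : 0 ≤ᵐ[P] A' := by
    filter_upwards [hw01, hA.nonneg] with x h1 h2
    rw [hA']
    exact add_nonneg h1.1 (mul_nonneg (sq_nonneg _) h2)
  have hLH : HasCondExp m P L' fun x => w x * H x ^ 2 + ((P[L | m]) x - r x * e x) := by
    have := (hasCondExp_of_measurable hm (hw.mul (hH.pow_const 2))).add hm
      (hasCondExp_cost hm hs hr hA.integrable_left h.integrable_const h.integrable_linear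
        (v := fun _ => 0) measurable_const hrm)
    refine this.congr (ae_of_all _ fun x => ?_) ?_
    · rw [hL']; simp
    · filter_upwards [hr.mul_eq] with x hx
      rw [← hx]
      simp only [Pi.mul_apply]
      ring
  have hLi : Integrable L' P := by
    refine hLH.integrable hm (hnn.mono fun x hx => by simpa using hx 0)
      (hwH.add (integrable_condExp (m := m) (f := L))) ?_
    filter_upwards [hr.mul_eq, hs.d_nonneg] with x h3 (h4 : 0 ≤ d x)
    have h5 : 0 ≤ r x * e x := by
      rw [← h3, ← mul_assoc, ← sq]
      exact mul_nonneg (sq_nonneg _) h4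
    simp only [Pi.add_apply]
    linarith
  have hXm : AEStronglyMeasurable (fun x => X x * A x) P :=
    hs.hasCondExp_mul.aestronglyMeasurable hm
  have hXQ : AEStronglyMeasurable (fun x => X x * Q x) P :=
    hr.hasCondExp_mul.aestronglyMeasurable hm
  have hXXA : AEStronglyMeasurable (fun x => X x ^ 2 * A x) P :=
    hs.hasCondExp_sq.aestronglyMeasurable hm
  have toAE : ∀ {f : Ω → ℝ}, Measurable[m] f → AEStronglyMeasurable f P := fun hf =>
    (hf.mono hm le_rfl).aestronglyMeasurable
  have hQm : AEStronglyMeasurable Q' P := by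
    have := ((toAE (hw.mul hH)).add h.integrable_linear.aestronglyMeasurable).add
      ((((toAE hb).mul hXQ).add ((toAE hrm).mul hXm)).neg.add
        ((toAE (hb.mul hrm)).mul hXXA))
    refine this.congr (ae_of_all _ fun x => ?_)
    simp only [Pi.add_apply, Pi.mul_apply, Pi.neg_apply]
    rw [hQ']; ring
  have hQi : Integrable Q' P := by
    refine Integrable.mono' (hLi.add hAi) hQm ?_
    filter_upwards [hnn, hA0'] with x h1 (h2 : 0 ≤ A' x)
    have h3 := sq_le_of_quadratic_nonneg h1
    have h4 : 0 ≤ L' x := by simpa using h1 0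
    rw [Real.norm_eq_abs, Pi.add_apply]
    exact abs_le_of_sq_le_sq (by nlinarith) (by linarith)
  have hCi : Integrable C' P := by
    refine Integrable.mono' (hK.add hAi) hCm ?_
    filter_upwards [hCA, hA0', hK0] with x h1 (h2 : 0 ≤ A' x) (h4 : 0 ≤ K' x)
    rw [Real.norm_eq_abs, Pi.add_apply]
    exact abs_le_of_sq_le_sq (by nlinarith) (by linarith)
  refine ⟨hLi, hQi, hCi, hnn, ?_⟩
  -- `C' - Q' = (C - Q) - b X (C - Q) + r X A - b r X² A`, where the first two terms are centred and
  -- the last two cancel in conditional expectation because `b * d = a`.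
  have hE : HasCondExp m P (fun x => C x - Q x) fun _ => 0 :=
      hasCondExp_zero_of_le hmm hm' (h.integrable_right.sub h.integrable_linear) h.balanced
  refine condExp_ae_eq_of_hasCondExp hm ?_ (hCi.sub hQi)
  have := (hE.add hm ((hr.hasCondExp_sub.mul_left hm hb).mul_left hm
    (Z := fun _ => -1) measurable_const)).add hm
      ((hs.hasCondExp_mul.mul_left hm hrm).add hm
      ((hs.hasCondExp_sq.mul_left hm (hb.mul hrm)).mul_left hm
        (Z := fun _ => -1) measurable_const))
  refine this.congr (ae_of_all _ fun x => ?_) ?_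
  · simp only [Pi.mul_apply]
    simp only [hC', hQ']; ring
  · filter_upwards [hs.mul_eq] with x hx
    simp only [Pi.zero_apply, Pi.mul_apply]
    rw [← hx]; ring

end OneStep

/-! ### Tail sums of discounted terms -/

section Tails

variable {Ω : Type*}

/-- `∑_{i=n}^N g i * ∏_{j=n+1}^i (1 - b j * ΔS j)`. -/
def tailLin (S : ℕ → Ω → ℝ) (N : ℕ) (b g : ℕ → Ω → ℝ) (n : ℕ) (x : Ω) : ℝ :=
  ∑ i ∈ Finset.Icc n N, g i x * discProd S b n i x

/-- `∑_{i=n}^N g i * ∏_{j=n+1}^i (1 - b j * ΔS j) ^ 2`. -/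
def tailSq (S : ℕ → Ω → ℝ) (N : ℕ) (b g : ℕ → Ω → ℝ) (n : ℕ) (x : Ω) : ℝ :=
  ∑ i ∈ Finset.Icc n N, g i x * discProd S b n i x ^ 2

theorem discProd_self (S b : ℕ → Ω → ℝ) (n : ℕ) (x : Ω) : discProd S b n n x = 1 := by
  simp [discProd]

theorem discProd_eq_mul (S b : ℕ → Ω → ℝ) {n i : ℕ} (h : n < i) (x : Ω) :
    discProd S b n i x = (1 - b (n + 1) x * incr S (n + 1) x) * discProd S b (n + 1) i x := by
  rw [discProd, ← Finset.insert_Ioc_add_one_left_eq_Ioc h, Finset.prod_insert (by simp)]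
  rfl

theorem sum_Icc_eq_add {n N : ℕ} {M : Type*} [AddCommMonoid M] (h : n ≤ N) (f : ℕ → M) :
    ∑ i ∈ Finset.Icc n N, f i = f n + ∑ i ∈ Finset.Icc (n + 1) N, f i := by
  rw [← Finset.insert_Icc_add_one_left_eq_Icc h, Finset.sum_insert (by simp)]

theorem tailLin_eq_add (S : ℕ → Ω → ℝ) {N n : ℕ} (b g : ℕ → Ω → ℝ) (h : n ≤ N) (x : Ω) :
    tailLin S N b g n x =
      g n x + (1 - b (n + 1) x * incr S (n + 1) x) * tailLin S N b g (n + 1) x := by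
  rw [tailLin, sum_Icc_eq_add h, discProd_self, mul_one, tailLin, Finset.mul_sum]
  congr 1
  refine Finset.sum_congr rfl fun i hi => ?_
  rw [discProd_eq_mul S b (Finset.mem_Icc.1 hi).1]
  ring

theorem tailSq_eq_add (S : ℕ → Ω → ℝ) {N n : ℕ} (b g : ℕ → Ω → ℝ) (h : n ≤ N) (x : Ω) :
    tailSq S N b g n x =
      g n x + (1 - b (n + 1) x * incr S (n + 1) x) ^ 2 * tailSq S N b g (n + 1) x := by
  rw [tailSq, sum_Icc_eq_add h, discProd_self, one_pow, mul_one, tailSq, Finset.mul_sum]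
  congr 1
  refine Finset.sum_congr rfl fun i hi => ?_
  rw [discProd_eq_mul S b (Finset.mem_Icc.1 hi).1]
  ring

theorem tailLin_top (S : ℕ → Ω → ℝ) (N : ℕ) (b g : ℕ → Ω → ℝ) (x : Ω) :
    tailLin S N b g N x = g N x := by
  simp [tailLin, discProd]

theorem tailSq_top (S : ℕ → Ω → ℝ) (N : ℕ) (b g : ℕ → Ω → ℝ) (x : Ω) :
    tailSq S N b g N x = g N x := by
  simp [tailSq, discProd]

theorem weighted_cauchy_schwarz {s : Finset ℕ} {w h d : ℕ → ℝ} (hw : ∀ i ∈ s, 0 ≤ w i) :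
    (∑ i ∈ s, h i * w i * d i) ^ 2 ≤ (∑ i ∈ s, w i * h i ^ 2) * ∑ i ∈ s, w i * d i ^ 2 := by
  have := Finset.sum_mul_sq_le_sq_mul_sq s (fun i => √(w i) * h i) fun i => √(w i) * d i
  refine (le_of_eq ?_).trans (this.trans (le_of_eq ?_))
  · congr 1
    refine Finset.sum_congr rfl fun i hi => ?_
    linear_combination (-(h i * d i)) * Real.mul_self_sqrt (hw i hi)
  · congr 1 <;> refine Finset.sum_congr rfl fun i hi => ?_ <;>
      rw [mul_pow, Real.sq_sqrt (hw i hi)]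

end Tails

/-! ### The backward induction -/

section Model

variable {Ω : Type*} {mΩ : MeasurableSpace Ω} {P : Measure[mΩ] Ω}
  {F : Filtration ℕ mΩ} {N : ℕ} {S H w : ℕ → Ω → ℝ}

/-- The standing assumptions: `S`, `H`, `w` are adapted up to time `N`, the price is locally
square integrable, the claims `H` are square integrable and the weights `w` lie in `[0, 1]`. -/
structure IsModel (P : Measure[mΩ] Ω) (F : Filtration ℕ mΩ) (N : ℕ) (S H w : ℕ → Ω → ℝ) :
    Prop where
  price : ∀ n ≤ N, Measurable[F n] (S n)
  condIntegrable : ∀ n, 1 ≤ n → n ≤ N → CondIntegrable (F (n - 1)) P fun x => incr S n x ^ 2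
  claim : ∀ n ≤ N, Measurable[F n] (H n)
  claim_sq : ∀ n ≤ N, MemLp (H n) 2 P
  weight : ∀ n ≤ N, Measurable[F n] (w n)
  weight_mem : ∀ n ≤ N, ∀ᵐ x ∂P, w n x ∈ Set.Icc (0 : ℝ) 1

/-- `∑_{i=n}^N w i * ∏_{j=n+1}^i (1 - β j * ΔS j) ^ 2`. -/
noncomputable def tailA (P : Measure[mΩ] Ω) (F : Filtration ℕ mΩ) (S w : ℕ → Ω → ℝ) (N : ℕ)
    (n : ℕ) : Ω → ℝ := tailSq S N (beta P F S w N) w n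

/-- `∑_{i=n}^N w i * ∏_{j=n+1}^i (1 - β j * ΔS j)`. -/
noncomputable def tailB (P : Measure[mΩ] Ω) (F : Filtration ℕ mΩ) (S w : ℕ → Ω → ℝ) (N : ℕ)
    (n : ℕ) : Ω → ℝ := tailLin S N (beta P F S w N) w n

/-- `∑_{i=n}^N H i * w i * ∏_{j=n+1}^i (1 - β j * ΔS j)`. -/
noncomputable def tailC (P : Measure[mΩ] Ω) (F : Filtration ℕ mΩ) (S H w : ℕ → Ω → ℝ) (N : ℕ)
    (n : ℕ) : Ω → ℝ :=
  tailLin S N (beta P F S w N) (fun i x => H i x * w i x) n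

theorem beta_measurable {n : ℕ} (h1 : 1 ≤ n) (hn : n ≤ N) :
    Measurable[F (n - 1)] (beta P F S w N n) := by
  rw [funext (beta_eq P F S w h1 hn)]
  exact (measurable_gCondExp _ _ _).div (measurable_gCondExp _ _ _)

/-- The quadratic `u ↦ L - 2 * u * Q + u ^ 2 * A` is the cost from time `n` on of the strategy
`ξ i = ρ i - β i * (wealth before i)` started from wealth `u`, and its expectation is a lower
bound for the cost from time `n` on of any wealth process `W` generated by predictable
holdings `ξ`. -/
structure IsTailValue (P : Measure[mΩ] Ω) (F : Filtration ℕ mΩ)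
    (S H w : ℕ → Ω → ℝ) (N n : ℕ) (L Q : Ω → ℝ) : Prop
    extends IsCostTail (F n) P (tailA P F S w N n) (tailC P F S H w N n) L Q where
  attained : ∀ (x : Ω) (W : ℕ → ℝ),
    (∀ i, n ≤ i → i < N → W (i + 1) = W i +
      (rho P F S H w N (i + 1) x - beta P F S w N (i + 1) x * W i) * incr S (i + 1) x) →
    ∑ i ∈ Finset.Icc n N, w i x * (H i x - W i) ^ 2 =
      L x - 2 * W n * Q x + W n ^ 2 * tailA P F S w N n x
  optimal : ∀ W ξ : ℕ → Ω → ℝ, Measurable[F n] (W n) →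
    (∀ i, n ≤ i → i < N → Measurable[F i] (ξ (i + 1))) →
    (∀ i x, n ≤ i → i < N → W (i + 1) x = W i x + ξ (i + 1) x * incr S (i + 1) x) →
    ∫⁻ x, ENNReal.ofReal (L x - 2 * W n x * Q x + W n x ^ 2 * tailA P F S w N n x) ∂P ≤
      ∑ i ∈ Finset.Icc n N, ∫⁻ x, ENNReal.ofReal (w i x * (H i x - W i x) ^ 2) ∂P

/-- The quadratic at time `0` bounds the hedging error of every admissible strategy from below. -/
theorem IsTailValue.le_hedgingError {L Q : Ω → ℝ} (h : IsTailValue P F S H w N 0 L Q) (c : ℝ)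
    {ξ : ℕ → Ω → ℝ} (hξ : Admissible F N ξ) :
    ∫⁻ x, ENNReal.ofReal (L x - 2 * c * Q x + c ^ 2 * tailA P F S w N 0 x) ∂P ≤
      hedgingError P S H w N c ξ := by
  have h0 : ∀ x, gain S ξ 0 x = 0 := fun x => by simp [gain]
  have := h.optimal (fun i x => c + gain S ξ i x) ξ (by simpa only [h0] using measurable_const)
    (fun i _ hi => hξ (i + 1) (by omega) hi) (fun i x _ _ => by
      simp only [gain]
      rw [Finset.sum_Icc_succ_top (by omega), add_assoc])
  simp only [h0, add_zero] at this
  simpa only [hedgingError, Nat.range_succ_eq_Icc_zero, sub_sub] using this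

namespace IsModel

variable (M : IsModel P F N S H w)
include M

theorem incr_measurable {n : ℕ} (hn : n ≤ N) : Measurable[F n] (incr S n) :=
  (M.price n hn).sub ((M.price (n - 1) (by omega)).mono (F.mono (by omega)) le_rfl)

theorem ae_weight_mem : ∀ᵐ x ∂P, ∀ n ≤ N, w n x ∈ Set.Icc (0 : ℝ) 1 := by
  rw [ae_all_iff]
  intro n
  by_cases hn : n ≤ N
  · filter_upwards [M.weight_mem n hn] with x hx _ using hx
  · exact ae_of_all _ fun x h => absurd h hn

theorem integrable_weight_claim {n : ℕ} (hn : n ≤ N) :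
    Integrable (fun x => w n x * H n x ^ 2) P := by
  refine (M.claim_sq n hn).integrable_sq.bdd_mul (c := 1)
    ((M.weight n hn).mono (F.le n) le_rfl).aestronglyMeasurable ?_
  filter_upwards [M.weight_mem n hn] with x hx
  rw [Real.norm_eq_abs, abs_of_nonneg hx.1]
  exact hx.2

theorem integrable_sum_claim (n : ℕ) :
    Integrable (fun x => ∑ i ∈ Finset.Icc n N, w i x * H i x ^ 2) P :=
  integrable_finsetSum _ fun _ hi => M.integrable_weight_claim (Finset.mem_Icc.1 hi).2

theorem sum_claim_nonneg (n : ℕ) :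
    0 ≤ᵐ[P] fun x => ∑ i ∈ Finset.Icc n N, w i x * H i x ^ 2 := by
  filter_upwards [M.ae_weight_mem] with x hx
  exact Finset.sum_nonneg fun i hi =>
    mul_nonneg (hx i (Finset.mem_Icc.1 hi).2).1 (sq_nonneg _)

theorem tailA_nonneg (n : ℕ) : 0 ≤ᵐ[P] tailA P F S w N n := by
  filter_upwards [M.ae_weight_mem] with x hx
  exact Finset.sum_nonneg fun i hi =>
    mul_nonneg (hx i (Finset.mem_Icc.1 hi).2).1 (sq_nonneg _)

theorem tailC_sq_le (n : ℕ) : ∀ᵐ x ∂P, tailC P F S H w N n x ^ 2 ≤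
    (∑ i ∈ Finset.Icc n N, w i x * H i x ^ 2) * tailA P F S w N n x := by
  filter_upwards [M.ae_weight_mem] with x hx
  exact weighted_cauchy_schwarz fun i hi => (hx i (Finset.mem_Icc.1 hi).2).1

theorem tailB_sq_le (n : ℕ) : ∀ᵐ x ∂P, tailB P F S w N n x ^ 2 ≤
    (N + 1 : ℝ) * tailA P F S w N n x := by
  filter_upwards [M.ae_weight_mem, M.tailA_nonneg n] with x hx h0
  have h1 := weighted_cauchy_schwarz (s := Finset.Icc n N) (w := fun i => w i x)
    (h := fun _ => 1) (d := fun i => discProd S (beta P F S w N) n i x)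
    fun i hi => (hx i (Finset.mem_Icc.1 hi).2).1
  simp only [one_mul, one_pow, mul_one] at h1
  refine h1.trans (mul_le_mul_of_nonneg_right ?_ h0)
  refine (Finset.sum_le_card_nsmul _ _ 1 fun i hi =>
    (hx i (Finset.mem_Icc.1 hi).2).2).trans ?_
  rw [nsmul_eq_mul, mul_one, Nat.card_Icc]
  exact_mod_cast Nat.sub_le _ _

theorem discProd_measurable {n i : ℕ} (hi : i ≤ N) :
    Measurable (discProd S (beta P F S w N) n i) := by
  refine Finset.measurable_prod _ fun j hj => ?_
  have hj' := Finset.mem_Ioc.1 hj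
  exact measurable_const.sub (((beta_measurable (by omega) (by omega)).mono (F.le _)
    le_rfl).mul ((M.incr_measurable (by omega)).mono (F.le _) le_rfl))

theorem tailLin_measurable {g : ℕ → Ω → ℝ} (hg : ∀ i ≤ N, Measurable (g i)) (n : ℕ) :
    Measurable (tailLin S N (beta P F S w N) g n) :=
  Finset.measurable_sum _ fun i hi =>
    (hg i (Finset.mem_Icc.1 hi).2).mul (M.discProd_measurable (Finset.mem_Icc.1 hi).2)

theorem tailB_measurable (n : ℕ) : Measurable (tailB P F S w N n) :=
  M.tailLin_measurable (fun i hi => (M.weight i hi).mono (F.le _) le_rfl) n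

theorem tailC_measurable (n : ℕ) : Measurable (tailC P F S H w N n) :=
  M.tailLin_measurable (fun i hi => ((M.claim i hi).mono (F.le _) le_rfl).mul
    ((M.weight i hi).mono (F.le _) le_rfl)) n

theorem optGain_measurable (c : ℝ) {n : ℕ} (hn : n ≤ N) :
    Measurable[F n] (optGain P F S H w N c n) := by
  induction n with
  | zero => exact measurable_const
  | succ n ih =>
    have hle := F.mono n.le_succ
    have hrho : Measurable[F n] (rho P F S H w N (n + 1)) :=
      (measurable_gCondExp (F n) P _).div (measurable_gCondExp (F n) P _)
    have hb : Measurable[F n] (beta P F S w N (n + 1)) := beta_measurable (by omega) hn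
    have ih := ih (by omega)
    exact (ih.mono hle le_rfl).add (((hrho.sub (hb.mul (measurable_const.add ih))).mono hle
      le_rfl).mul (M.incr_measurable hn))

theorem admissible_optStrategy (c : ℝ) : Admissible F N (optStrategy P F S H w N c) := by
  intro n h1 hn
  have hrho : Measurable[F (n - 1)] (rho P F S H w N n) :=
    (measurable_gCondExp _ P _).div (measurable_gCondExp _ P _)
  exact hrho.sub ((beta_measurable h1 hn).mul
    (measurable_const.add (M.optGain_measurable c (by omega))))

/-- The strategy `ξ*(c)` attains the lower bound given by the quadratic at time `0`. -/
theorem hedgingError_optStrategy {L Q : Ω → ℝ} (h : IsTailValue P F S H w N 0 L Q) (c : ℝ) :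
    hedgingError P S H w N c (optStrategy P F S H w N c) =
      ∫⁻ x, ENNReal.ofReal (L x - 2 * c * Q x + c ^ 2 * tailA P F S w N 0 x) ∂P := by
  simp only [hedgingError, Nat.range_succ_eq_Icc_zero, gain_optStrategy]
  rw [← lintegral_finsetSum']
  · refine lintegral_congr_ae ?_
    filter_upwards [M.ae_weight_mem] with x hx
    rw [← ENNReal.ofReal_sum_of_nonneg fun i hi =>
      mul_nonneg (hx i (Finset.mem_Icc.1 hi).2).1 (sq_nonneg _)]
    have := h.attained x (fun i => c + optGain P F S H w N c i x) fun i _ _ => by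
      simp only [optGain]
      ring
    simp only [sub_sub, this]
    simp [optGain]
  · intro i hi
    have hi' := (Finset.mem_Icc.1 hi).2
    exact ((((M.weight i hi').mul ((((M.claim i hi').sub measurable_const).sub
      (M.optGain_measurable c hi')).pow_const 2)).mono (F.le i)
        le_rfl).ennreal_ofReal).aemeasurable

variable [IsProbabilityMeasure P]

theorem stepCoeff_of_isUnitTail {n : ℕ} (hn : n < N)
    (h : IsUnitTail (F (n + 1)) P (tailA P F S w N (n + 1)) (tailB P F S w N (n + 1))) :
    StepCoeff (F n) P (incr S (n + 1)) (tailA P F S w N (n + 1)) (tailB P F S w N (n + 1))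
      (alpha P F S w N (n + 1)) (beta P F S w N (n + 1)) (delta P F S w N (n + 1)) :=
  h.stepCoeff (F.mono n.le_succ) (F.le _) (M.incr_measurable hn)
    (M.condIntegrable (n + 1) (by omega) hn) (by positivity) (M.tailB_sq_le _)
    (beta_eq P F S w (by omega) hn)

theorem isUnitTail {n : ℕ} (hn : n ≤ N) :
    IsUnitTail (F n) P (tailA P F S w N n) (tailB P F S w N n) := by
  induction hn using Nat.decreasingInduction with
  | self =>
    have hA : tailA P F S w N N = w N := funext fun x => tailSq_top _ _ _ _ x
    have hB : tailB P F S w N N = w N := funext fun x => tailLin_top _ _ _ _ x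
    have hw := M.weight N le_rfl
    have hi : Integrable (w N) P := by
      refine Integrable.of_bound (hw.mono (F.le N) le_rfl).aestronglyMeasurable 1 ?_
      filter_upwards [M.weight_mem N le_rfl] with x hx
      rw [Real.norm_eq_abs, abs_of_nonneg hx.1]
      exact hx.2
    rw [hA, hB]
    refine ⟨hi, hi, (M.weight_mem N le_rfl).mono fun x hx => hx.1, ⟨1, ?_⟩, ?_⟩
    · rw [condExp_of_stronglyMeasurable (F.le N) hw.stronglyMeasurable hi]
      exact (M.weight_mem N le_rfl).mono fun x hx => hx.2
    · simp only [sub_self]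
      exact (condExp_zero (μ := P) (m := F N) (α := Ω) (E := ℝ)).eventuallyEq
  | of_succ n hn ih =>
    exact ih.step (F.mono n.le_succ) (F.le _) (M.stepCoeff_of_isUnitTail hn ih)
      (M.weight n hn.le) (M.weight_mem n hn.le) (c := N + 1) (by positivity)
      (tailSq_eq_add _ _ _ hn.le) (tailLin_eq_add _ _ _ hn.le)
      (M.tailB_measurable n).aestronglyMeasurable (M.tailB_sq_le n)

theorem stepCoeff {n : ℕ} (hn : n < N) :
    StepCoeff (F n) P (incr S (n + 1)) (tailA P F S w N (n + 1)) (tailB P F S w N (n + 1))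
      (alpha P F S w N (n + 1)) (beta P F S w N (n + 1)) (delta P F S w N (n + 1)) :=
  M.stepCoeff_of_isUnitTail hn (M.isUnitTail hn)

theorem costCoeff {n : ℕ} (hn : n < N) {L Q : Ω → ℝ}
    (h : IsCostTail (F (n + 1)) P (tailA P F S w N (n + 1)) (tailC P F S H w N (n + 1)) L Q) :
    CostCoeff (F n) P (incr S (n + 1)) (tailC P F S H w N (n + 1)) Q
      (delta P F S w N (n + 1)) (eta P F S H w N (n + 1)) (rho P F S H w N (n + 1)) :=
  h.costCoeff (F.mono n.le_succ) (F.le _) (M.isUnitTail hn) (M.stepCoeff hn)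
    (M.incr_measurable hn) (M.integrable_sum_claim _) (M.sum_claim_nonneg _)
    (M.tailC_sq_le _) fun _ => rfl

theorem isTailValue_top : IsTailValue P F S H w N N (fun x => w N x * H N x ^ 2)
    (fun x => w N x * H N x) := by
  have hA : tailA P F S w N N = w N := funext fun x => tailSq_top _ _ _ _ x
  have hC : tailC P F S H w N N = fun x => H N x * w N x :=
    funext fun x => tailLin_top _ _ _ _ x
  have e : ∀ (x : Ω) (u : ℝ), w N x * H N x ^ 2 - 2 * u * (w N x * H N x) + u ^ 2 * w N x =
      w N x * (H N x - u) ^ 2 := fun x u => by ring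
  have hi : Integrable (fun x => w N x * H N x) P := by
    refine ((M.claim_sq N le_rfl).integrable one_le_two).bdd_mul (c := 1)
      ((M.weight N le_rfl).mono (F.le N) le_rfl).aestronglyMeasurable ?_
    filter_upwards [M.weight_mem N le_rfl] with x hx
    rw [Real.norm_eq_abs, abs_of_nonneg hx.1]
    exact hx.2
  refine ⟨⟨M.integrable_weight_claim le_rfl, hi, ?_, ?_, ?_⟩, ?_, ?_⟩
  · rw [hC]; simpa only [mul_comm] using hi
  · filter_upwards [M.weight_mem N le_rfl] with x hx u
    rw [hA, e]
    exact mul_nonneg hx.1 (sq_nonneg _)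
  · have : (fun x => tailC P F S H w N N x - w N x * H N x) = 0 := by
      funext x; rw [hC]; simp only [Pi.zero_apply]; ring
    rw [this, condExp_zero]
  · intro x W _
    rw [hA, e]; simp
  · intro W ξ _ _ _
    simp [hA, e]

theorem isTailValue_step {n : ℕ} (hn : n < N) {L Q : Ω → ℝ}
    (h : IsTailValue P F S H w N (n + 1) L Q) :
    IsTailValue P F S H w N n
      (fun x => w n x * H n x ^ 2 + (L x - 2 * (rho P F S H w N (n + 1) x * incr S (n + 1) x) *
        Q x + (rho P F S H w N (n + 1) x * incr S (n + 1) x) ^ 2 * tailA P F S w N (n + 1) x))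
      (fun x => w n x * H n x + (1 - beta P F S w N (n + 1) x * incr S (n + 1) x) *
        (Q x - rho P F S H w N (n + 1) x * incr S (n + 1) x * tailA P F S w N (n + 1) x)) := by
  have hr := M.costCoeff hn h.toIsCostTail
  have hs := M.stepCoeff hn
  have hT := M.isUnitTail hn
  have hA : ∀ x, tailA P F S w N n x = w n x +
      (1 - beta P F S w N (n + 1) x * incr S (n + 1) x) ^ 2 * tailA P F S w N (n + 1) x :=
    tailSq_eq_add S _ w hn.le
  refine ⟨h.toIsCostTail.step (F.mono n.le_succ) (F.le _) hT hs hr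
      (M.weight n hn.le) (M.weight_mem n hn.le) (M.claim n hn.le)
      (M.integrable_weight_claim hn.le) hA (M.isUnitTail hn.le).integrable_left
      (tailLin_eq_add _ _ _ hn.le) (M.tailC_measurable n).aestronglyMeasurable
      (M.integrable_sum_claim n) (M.sum_claim_nonneg n) (M.tailC_sq_le n)
      (fun _ => rfl) (fun _ => rfl), ?_, ?_⟩
  · intro x W hW
    rw [sum_Icc_eq_add hn.le, h.attained x W fun i hi => hW i (by omega), hW n le_rfl hn,
      hA]
    ring
  · intro W ξ hWm hξ hW
    rw [sum_Icc_eq_add hn.le]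
    have hW1 : Measurable[F (n + 1)] (W (n + 1)) := by
      rw [funext fun x => hW n x le_rfl hn]
      exact (hWm.mono (F.mono n.le_succ) le_rfl).add
        (((hξ n le_rfl hn).mono (F.mono n.le_succ) le_rfl).mul (M.incr_measurable hn))
    -- Later optimality from the wealth `W (n + 1)`, then optimality of the holding over one period.
    have h1 := h.optimal W ξ hW1 (fun i hi => hξ i (by omega)) fun i x hi => hW i x (by omega)
    have h2 := lintegral_cost_le (F.le n) hs hr hT.integrable_left h.integrable_const
      h.integrable_linear h.nonneg hWm (hξ n le_rfl hn)
    have hmeas : AEMeasurable (fun x => ENNReal.ofReal (w n x * (H n x - W n x) ^ 2)) P :=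
      ((((M.weight n hn.le).mul (((M.claim n hn.le).sub hWm).pow_const 2)).mono (F.le n)
        le_rfl).ennreal_ofReal).aemeasurable
    simp only [hW n _ le_rfl hn] at h1
    refine le_trans (le_of_eq ?_) (add_le_add le_rfl (h2.trans h1))
    rw [← lintegral_add_left' hmeas]
    refine lintegral_congr_ae ?_
    filter_upwards [M.weight_mem n hn.le, h.nonneg] with x h3 h4
    rw [← ENNReal.ofReal_add (mul_nonneg h3.1 (sq_nonneg _)) (h4 _)]
    congr 1
    rw [hA]
    ring

theorem exists_isTailValue {n : ℕ} (hn : n ≤ N) :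
    ∃ L Q : Ω → ℝ, IsTailValue P F S H w N n L Q := by
  induction hn using Nat.decreasingInduction with
  | self => exact ⟨_, _, M.isTailValue_top⟩
  | of_succ n hn ih =>
    obtain ⟨L, Q, h⟩ := ih
    exact ⟨_, _, M.isTailValue_step hn h⟩

/-! ### The optimal strategy and the optimal capital -/

theorem hedgingError_optStrategy_eq_valueFn (c : ℝ) :
    hedgingError P S H w N c (optStrategy P F S H w N c) = valueFn P F S H w N c := by
  obtain ⟨L, Q, h⟩ := M.exists_isTailValue (Nat.zero_le N)
  refine le_antisymm (le_iInf₂ fun ξ hξ => ?_) (iInf₂_le _ (M.admissible_optStrategy c))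
  rw [M.hedgingError_optStrategy h]
  exact h.le_hedgingError c hξ

theorem hedgingError_optStrategy_eq_ofReal {L Q : Ω → ℝ}
    (h : IsTailValue P F S H w N 0 L Q) (c : ℝ) :
    hedgingError P S H w N c (optStrategy P F S H w N c) =
      ENNReal.ofReal (∫ x, L x ∂P - 2 * c * ∫ x, Q x ∂P +
        c ^ 2 * ∫ x, tailA P F S w N 0 x ∂P) := by
  have hA := (M.isUnitTail (Nat.zero_le N)).integrable_left
  have h1 := h.integrable_linear.const_mul (2 * c)
  have h2 := hA.const_mul (c ^ 2)
  have h3 := ofReal_integral_eq_lintegral_ofReal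
    (f := fun x => L x - 2 * c * Q x + c ^ 2 * tailA P F S w N 0 x)
    ((h.integrable_const.sub h1).add h2) (h.nonneg.mono fun x hx => hx c)
  rw [M.hedgingError_optStrategy h, ← h3]
  congr 1
  refine (integral_add (h.integrable_const.sub h1) h2).trans ?_
  simp only [Pi.sub_apply]
  rw [integral_sub h.integrable_const h1,
    integral_const_mul, integral_const_mul]

theorem zProc_integrable {n : ℕ} (hn : n ≤ N) : Integrable (zProc P F S w N n) P ∧
    Integrable (fun x => zProc P F S w N n x * H n x) P := by
  have hA := (M.isUnitTail (Nat.zero_le N)).integrable_left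
  have hZ : Measurable (zProc P F S w N n) :=
    ((M.weight n hn).mono (F.le n) le_rfl).mul (M.discProd_measurable hn)
  have hle : ∀ᵐ x ∂P, (0 ≤ w n x ∧ w n x ≤ 1) ∧
      w n x * discProd S (beta P F S w N) 0 n x ^ 2 ≤ tailA P F S w N 0 x := by
    filter_upwards [M.ae_weight_mem] with x hx
    refine ⟨hx n hn, ?_⟩
    exact Finset.single_le_sum (f := fun i => w i x * discProd S (beta P F S w N) 0 i x ^ 2)
      (fun i hi => mul_nonneg (hx i (Finset.mem_Icc.1 hi).2).1 (sq_nonneg _))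
      (Finset.mem_Icc.2 ⟨n.zero_le, hn⟩)
  refine ⟨Integrable.mono' ((integrable_const (1 : ℝ)).add hA) hZ.aestronglyMeasurable ?_,
    Integrable.mono' ((M.integrable_weight_claim hn).add hA)
      (hZ.mul ((M.claim n hn).mono (F.le n) le_rfl)).aestronglyMeasurable ?_⟩
  · filter_upwards [hle] with x ⟨⟨h1, h2⟩, h3⟩
    rw [Real.norm_eq_abs, Pi.add_apply, zProc, abs_mul, abs_of_nonneg h1]
    rw [← sq_abs] at h3
    nlinarith [mul_nonneg h1 (sq_nonneg (|discProd S (beta P F S w N) 0 n x| - 1)),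
      mul_nonneg h1 (sq_nonneg |discProd S (beta P F S w N) 0 n x|)]
  · filter_upwards [hle] with x ⟨⟨h1, h2⟩, h3⟩
    rw [Real.norm_eq_abs, Pi.add_apply, zProc, abs_mul, abs_mul, abs_of_nonneg h1]
    rw [← sq_abs] at h3
    rw [← sq_abs (H n x)]
    nlinarith [mul_nonneg h1 (sq_nonneg (|discProd S (beta P F S w N) 0 n x| - |H n x|)),
      mul_nonneg h1 (sq_nonneg |discProd S (beta P F S w N) 0 n x|),
      mul_nonneg h1 (sq_nonneg |H n x|)]

theorem sum_integral_zProc : ∑ n ∈ Finset.range (N + 1), ∫ x, zProc P F S w N n x ∂P =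
    ∫ x, tailA P F S w N 0 x ∂P := by
  have h := M.isUnitTail (Nat.zero_le N)
  have h1 : ∫ x, tailA P F S w N 0 x - tailB P F S w N 0 x ∂P = 0 := by
    rw [← integral_condExp (F.le 0), integral_congr_ae h.balanced]
    simp
  rw [integral_sub h.integrable_left h.integrable_right, sub_eq_zero] at h1
  rw [h1, Nat.range_succ_eq_Icc_zero, ← integral_finsetSum _ fun i hi =>
    (M.zProc_integrable (Finset.mem_Icc.1 hi).2).1]
  rfl

theorem sum_integral_zProc_mul {L Q : Ω → ℝ} (h : IsTailValue P F S H w N 0 L Q) :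
    ∑ n ∈ Finset.range (N + 1), ∫ x, zProc P F S w N n x * H n x ∂P = ∫ x, Q x ∂P := by
  have h1 : ∫ x, tailC P F S H w N 0 x - Q x ∂P = 0 := by
    rw [← integral_condExp (F.le 0), integral_congr_ae h.balanced]
    simp
  rw [integral_sub h.integrable_right h.integrable_linear, sub_eq_zero] at h1
  rw [← h1, Nat.range_succ_eq_Icc_zero, ← integral_finsetSum _ fun i hi =>
    (M.zProc_integrable (Finset.mem_Icc.1 hi).2).2]
  refine integral_congr_ae (ae_of_all _ fun x => ?_)
  simp only [tailC, tailLin, zProc]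
  refine Finset.sum_congr rfl fun i _ => ?_
  ring

theorem integral_linear_eq_zero {L Q : Ω → ℝ} (h : IsTailValue P F S H w N 0 L Q)
    (h0 : ∫ x, tailA P F S w N 0 x ∂P = 0) : ∫ x, Q x ∂P = 0 := by
  have hT := M.isUnitTail (Nat.zero_le N)
  rw [integral_eq_zero_iff_of_nonneg_ae hT.nonneg hT.integrable_left] at h0
  refine integral_eq_zero_of_ae ?_
  filter_upwards [h0, h.nonneg] with x h1 h2
  have h3 := sq_le_of_quadratic_nonneg h2
  rw [h1, Pi.zero_apply, mul_zero] at h3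
  exact pow_eq_zero_iff two_ne_zero |>.1 (le_antisymm h3 (sq_nonneg _))

theorem valueFn_optCapital_le (c : ℝ) :
    valueFn P F S H w N (optCapital P F S H w N) ≤ valueFn P F S H w N c := by
  obtain ⟨L, Q, h⟩ := M.exists_isTailValue (Nat.zero_le N)
  rw [← M.hedgingError_optStrategy_eq_valueFn, ← M.hedgingError_optStrategy_eq_valueFn,
    M.hedgingError_optStrategy_eq_ofReal h, M.hedgingError_optStrategy_eq_ofReal h]
  refine ENNReal.ofReal_le_ofReal ?_
  have hA0 : 0 ≤ ∫ x, tailA P F S w N 0 x ∂P := integral_nonneg_of_ae (M.tailA_nonneg 0)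
  -- The value is `E[L] - 2 c E[Q] + c² E[A]`, and `optCapital` solves the first-order condition.
  have hQ : optCapital P F S H w N * ∫ x, tailA P F S w N 0 x ∂P = ∫ x, Q x ∂P := by
    rw [optCapital, M.sum_integral_zProc, M.sum_integral_zProc_mul h]
    by_cases h0 : ∫ x, tailA P F S w N 0 x ∂P = 0
    · rw [h0, mul_zero, M.integral_linear_eq_zero h h0]
    · exact div_mul_cancel₀ _ h0
  rw [← hQ]
  nlinarith [mul_nonneg hA0 (sq_nonneg (c - optCapital P F S H w N))]

end IsModel

end Model

end QuadHedge

theorem mainTheorem2 {Ω : Type*} {mΩ : MeasurableSpace Ω} (P : Measure Ω)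
    [IsProbabilityMeasure P] (F : Filtration ℕ mΩ) (N : ℕ) (hN : 1 ≤ N)
    (S H w : ℕ → Ω → ℝ)
    (hS : ∀ n ≤ N, Measurable[F n] (S n))
    (hS2 : ∀ n, 1 ≤ n → n ≤ N →
      QuadHedge.CondIntegrable (F (n - 1)) P (fun x => (S n x - S (n - 1) x) ^ 2))
    (hH : ∀ n ≤ N, Measurable[F n] (H n))
    (hH2 : ∀ n ≤ N, MemLp (H n) 2 P)
    (hw : ∀ n ≤ N, Measurable[F n] (w n))
    (hw01 : ∀ n ≤ N, ∀ᵐ x ∂P, w n x ∈ Set.Icc (0 : ℝ) 1) :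
    -- the coefficients are well defined, and their only degenerate quotients are `0 / 0`
    (∀ n, 1 ≤ n → n ≤ N →
      QuadHedge.CondIntegrable (F (n - 1)) P
        (QuadHedge.alphaArg S w N (QuadHedge.beta P F S w N) n) ∧
      QuadHedge.CondIntegrable (F (n - 1)) P
        (QuadHedge.etaArg S H w N (QuadHedge.beta P F S w N) n) ∧
      QuadHedge.CondIntegrable (F (n - 1)) P
        (QuadHedge.deltaArg S w N (QuadHedge.beta P F S w N) n) ∧
      ∀ᵐ x ∂P, QuadHedge.delta P F S w N n x = 0 →
        QuadHedge.alpha P F S w N n x = 0 ∧ QuadHedge.eta P F S H w N n x = 0) ∧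
    -- so is the optimal capital
    (∀ n ≤ N, Integrable (QuadHedge.zProc P F S w N n) P ∧
      Integrable (fun x => QuadHedge.zProc P F S w N n x * H n x) P) ∧
    ((∑ n ∈ Finset.range (N + 1), ∫ x, QuadHedge.zProc P F S w N n x ∂P) = 0 →
      (∑ n ∈ Finset.range (N + 1), ∫ x, QuadHedge.zProc P F S w N n x * H n x ∂P) = 0) ∧
    -- for each capital `c` the inner minimum is attained at the strategy `ξ*(c)`
    (∀ c : ℝ, QuadHedge.Admissible F N (QuadHedge.optStrategy P F S H w N c) ∧
      QuadHedge.hedgingError P S H w N c (QuadHedge.optStrategy P F S H w N c) =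
        QuadHedge.valueFn P F S H w N c) ∧
    -- the outer minimum is attained at `c*`, with a finite value
    (∀ c : ℝ, QuadHedge.valueFn P F S H w N (QuadHedge.optCapital P F S H w N) ≤
      QuadHedge.valueFn P F S H w N c) ∧
    -- `(c*, ξ*(c*))` solves the joint problem
    QuadHedge.hedgingError P S H w N (QuadHedge.optCapital P F S H w N)
      (QuadHedge.optStrategy P F S H w N (QuadHedge.optCapital P F S H w N)) < ∞ ∧
    ∀ (c : ℝ) (ξ : ℕ → Ω → ℝ), QuadHedge.Admissible F N ξ →
      QuadHedge.hedgingError P S H w N (QuadHedge.optCapital P F S H w N)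
        (QuadHedge.optStrategy P F S H w N (QuadHedge.optCapital P F S H w N)) ≤
      QuadHedge.hedgingError P S H w N c ξ := by
  have M : QuadHedge.IsModel P F N S H w := ⟨hS, hS2, hH, hH2, hw, hw01⟩
  refine ⟨fun n h1 hn => ?_, fun n hn => M.zProc_integrable hn, fun h0 => ?_,
    fun c => ⟨M.admissible_optStrategy c, M.hedgingError_optStrategy_eq_valueFn c⟩,
    M.valueFn_optCapital_le, ?_, fun c ξ hξ => ?_⟩
  · obtain ⟨k, rfl⟩ : ∃ k, n = k + 1 := ⟨n - 1, by omega⟩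
    obtain ⟨L, Q, h⟩ := M.exists_isTailValue hn
    have hs := M.stepCoeff hn
    have hr := M.costCoeff hn h.toIsCostTail
    refine ⟨hs.hasCondExp_mul_right.condIntegrable (F.le k),
      hr.hasCondExp_mul_right.condIntegrable (F.le k),
      hs.hasCondExp_sq.condIntegrable (F.le k), ?_⟩
    filter_upwards [hs.degenerate, hr.degenerate] with x e1 e2 h0 using ⟨e1 h0, e2 h0⟩
  · obtain ⟨L, Q, h⟩ := M.exists_isTailValue (Nat.zero_le N)
    rw [M.sum_integral_zProc] at h0
    rw [M.sum_integral_zProc_mul h, M.integral_linear_eq_zero h h0]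
  · obtain ⟨L, Q, h⟩ := M.exists_isTailValue (Nat.zero_le N)
    rw [M.hedgingError_optStrategy_eq_ofReal h]
    exact ENNReal.ofReal_lt_top
  · rw [M.hedgingError_optStrategy_eq_valueFn]
    exact (M.valueFn_optCapital_le c).trans (iInf₂_le ξ hξ)
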